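/- Let $k\ge 2$ and $d\ge 1$, and let $\rho=\sum_{i_0,i_1,j_0,j_1=1}^{k}|i_0i_1\rangle\langle j_0j_1|\otimes\rho_{i_0i_1,j_0j_1}$ be a density matrix (positive semidefinite, trace one) on $(\mathbb{C}^k\otimes\mathbb{C}^k)\otimes(\mathbb{C}^d\otimes\mathbb{C}^d)$. Let $\rho_{k,1}$ be the density matrix on $(\mathbb{C}^k)^{\otimes k}\otimes(\mathbb{C}^d\otimes\mathbb{C}^d)$ obtained from $\rho$ by replacing the first factor $\mathbb{C}^k$ with $\mathrm{Alt}^{k-1}\mathbb{C}^k\subset(\mathbb{C}^k)^{\otimes(k-1)}$ through the isometry $$|i\rangle\mapsto\frac{1}{\sqrt{(k-1)!}}\sum_{a_2,\dots,a_k=1}^{k}\epsilon_{a_2\cdots a_k i}\,|a_2\cdots a_k\rangle ,$$ and let $$\mathcal{T}_U[\rho_{k,1}]=\int_{\mathrm{U}(k)}(U^{\otimes k}\otimes\mathbf{1})\,\rho_{k,1}\,(U^{\otimes k}\otimes\mathbf{1})^\dagger\,dU$$ be its twirl with respect to the Haar probability measure of $\mathrm{U}(k)$. For a Young diagram $\lambda$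 with $k$ boxes let $\mathbb{Y}_\lambda$ be the Specht module of $S_k$, $\mathbb{U}_{k,\lambda}$ the corresponding representation of $\mathrm{U}(k)$ (the image of a Young symmetrizer of shape $\lambda$ on $(\mathbb{C}^k)^{\otimes k}$), and let the $\lambda$-block of $(\mathbb{C}^k)^{\otimes k}$ be its $\mathbb{Y}_\lambda$-isotypic component $\mathbb{U}_{k,\lambda}\otimes\mathbb{Y}_\lambda$. For a standard Young tableau $p$ of shape $\lambda$ let $|p\rangle\in\mathbb{Y}_\lambda$ be the unit vector of the Young (Gelfand–Tsetlin) basis, so that $\mathbb{U}_{k,\lambda}\otimes|p\rangle$ is the subspace of those tensors which, for every $j\le k$, lie in the isotypic component, under the group $S_j$ permuting the first $j$ factors, of the diagram formed by the entries $1,\dots,j$ of $p$; the orthogonal projector onto it is denoted $\mathbf{1}_{\mathbb{U}_{k,\lambda}}\otimes|p\rangle\langle p|$. Let $a$ be the standard tableau of shape $(1^k)$, and let $s$ be the standard tableau of shape $(2,1^{k-2})$ with first column $1,\dots,k-1$ and with $k$ in the second box of the first row. Then $\mathbb{U}_{k,(1^k)}\otimes|a\rangle$ and $\mathbb{U}_{k,(2,1^{k-2})}\otimes|s\rangle$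 are orthogonal to each other, they are invariant under all $U^{\otimes k}$, they carry irreducible representations of $\mathrm{U}(k)$ equivalent to $\mathbb{U}_{k,(1^k)}$ and $\mathbb{U}_{k,(2,1^{k-2})}$ respectively, and their dimensions are $1$ and $k^2-1$. Moreover there are real numbers $w_{(1^k)},w_{(2,1^{k-2})}\ge 0$ with $w_{(1^k)}+w_{(2,1^{k-2})}=1$ and density matrices $\rho_{a,a},\rho_{s,s}$ on $\mathbb{C}^d\otimes\mathbb{C}^d$ such that $$\mathcal{T}_U[\rho_{k,1}]=w_{(1^k)}\,\mathbf{1}_{\mathbb{U}_{k,(1^k)}}\otimes|a\rangle\langle a|\otimes\rho_{a,a}+w_{(2,1^{k-2})}\,\frac{\mathbf{1}_{\mathbb{U}_{k,(2,1^{k-2})}}}{k^2-1}\otimes|s\rangle\langle s|\otimes\rho_{s,s},$$ and for every other Young diagram $\lambda$ with $k$ boxes the $\lambda$-block of $\mathcal{T}_U[\rho_{k,1}]$ vanishes: $(P_\lambda\otimes\mathbf{1})\,\mathcal{T}_U[\rho_{k,1}]=0$, where $P_\lambda$ is the orthogonal projector onto the $\lambda$-block of $(\mathbb{C}^k)^{\otimes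 k}$. -/

import Mathlib

open MeasureTheory
open scoped ComplexOrder Kronecker

noncomputable section

namespace Twirl

/-! ### Haar measure on `U(k)` -/

/-- The unitary group `U(k)`. -/
abbrev UG (k : ℕ) : Type := Matrix.unitaryGroup (Fin k) ℂ

theorem isCompact_unitaryGroup (k : ℕ) :
    IsCompact ((Matrix.unitaryGroup (Fin k) ℂ : Submonoid (Matrix (Fin k) (Fin k) ℂ)) :
      Set (Matrix (Fin k) (Fin k) ℂ)) := by
  have hK : IsCompact (Set.univ.pi fun _ : Fin k => Set.univ.pi fun _ : Fin k =>
      Metric.closedBall (0 : ℂ) 1) :=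
    isCompact_univ_pi fun _ => isCompact_univ_pi fun _ => isCompact_closedBall 0 1
  refine IsCompact.of_isClosed_subset hK ?_ ?_
  · have h : ((Matrix.unitaryGroup (Fin k) ℂ : Submonoid (Matrix (Fin k) (Fin k) ℂ)) :
        Set (Matrix (Fin k) (Fin k) ℂ)) = {A | A * star A = 1} := by
      ext A
      exact Matrix.mem_unitaryGroup_iff
    rw [h]
    exact isClosed_eq (by fun_prop) continuous_const
  · intro U hU i _ j _
    rw [mem_closedBall_zero_iff]
    exact entry_norm_bound_of_unitary hU i j

instance instCompactSpaceUG (k : ℕ) : CompactSpace (UG k) :=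
  isCompact_iff_compactSpace.mp (isCompact_unitaryGroup k)

instance instMeasurableSpaceUG (k : ℕ) : MeasurableSpace (UG k) := borel _

instance instBorelSpaceUG (k : ℕ) : BorelSpace (UG k) := ⟨rfl⟩

/-- The Haar measure on `U(k)`, normalized to total mass one. -/
def haarU (k : ℕ) : Measure (UG k) := Measure.haarMeasure ⊤

/-! ### The tensor power `(ℂ^k)^{⊗n}` with its commuting actions of `S_n` and `U(k)` -/

/-- `(ℂ^k)^{⊗n}` in the computational basis `|i₁ … iₙ⟩`. -/
abbrev TensorSpace (n k : ℕ) : Type := EuclideanSpace ℂ (Fin n → Fin k)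

/-- The action of `S_n` by permutation of tensor factors: the factor in slot `s` moves to
slot `π s`. -/
def permRep (n k : ℕ) : Representation ℂ (Equiv.Perm (Fin n)) (TensorSpace n k) where
  toFun π :=
    { toFun := fun v => WithLp.toLp 2 fun x => v (x ∘ π)
      map_add' := fun _ _ => rfl
      map_smul' := fun _ _ => rfl }
  map_one' := rfl
  map_mul' _ _ := rfl

/-- The matrix of `U^{⊗n}`. -/
def tensorPow (n : ℕ) {k : ℕ} (U : Matrix (Fin k) (Fin k) ℂ) :
    Matrix (Fin n → Fin k) (Fin n → Fin k) ℂ :=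
  Matrix.of fun x y => ∏ s, U (x s) (y s)

/-- The operator `U^{⊗n}` on `(ℂ^k)^{⊗n}`. -/
def unitaryAct (n : ℕ) {k : ℕ} (U : UG k) : TensorSpace n k →ₗ[ℂ] TensorSpace n k :=
  Matrix.toEuclideanLin (tensorPow n (U : Matrix (Fin k) (Fin k) ℂ))

/-- A subspace stable under all `U^{⊗n}`. -/
def IsInvariant {n k : ℕ} (W : Submodule ℂ (TensorSpace n k)) : Prop :=
  ∀ U : UG k, ∀ v ∈ W, unitaryAct n U v ∈ W

/-- A subspace carrying an irreducible representation of `U(k)`. -/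
def IsIrreducible {n k : ℕ} (W : Submodule ℂ (TensorSpace n k)) : Prop :=
  IsInvariant W ∧ W ≠ ⊥ ∧
    ∀ W' : Submodule ℂ (TensorSpace n k), W' ≤ W → IsInvariant W' → W' = ⊥ ∨ W' = W

/-- Two invariant subspaces carrying equivalent representations of `U(k)`. -/
def AreEquivalent {n k : ℕ} (W W' : Submodule ℂ (TensorSpace n k)) : Prop :=
  IsInvariant W ∧ IsInvariant W' ∧
    ∃ e : W ≃ₗ[ℂ] W', ∀ (U : UG k) (v w : W),
      (w : TensorSpace n k) = unitaryAct n U v →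
        (e w : TensorSpace n k) = unitaryAct n U (e v)

/-- The matrix of the orthogonal projector onto a subspace. -/
def projMatrix {n k : ℕ} (W : Submodule ℂ (TensorSpace n k)) :
    Matrix (Fin n → Fin k) (Fin n → Fin k) ℂ :=
  Matrix.of fun x y => W.starProjection (EuclideanSpace.single y (1 : ℂ)) x

/-! ### Young tableaux, Specht modules and Schur–Weyl blocks -/

/-- A standard Young tableau of shape `μ` with entries `0, …, n - 1`; `pos i` is the box
(row, column) that contains the entry `i`. -/
structure StdTableau (n : ℕ) (μ : YoungDiagram) where
  pos : Fin n → ℕ × ℕ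
  pos_injective : Function.Injective pos
  range_pos : Set.range pos = {c | c ∈ μ}
  row_increasing : ∀ i j, (pos i).1 = (pos j).1 → (pos i).2 < (pos j).2 → i < j
  col_increasing : ∀ i j, (pos i).2 = (pos j).2 → (pos i).1 < (pos j).1 → i < j

/-- The Young symmetrizer `(∑_{σ row-preserving} σ) (∑_{τ column-preserving} sgn(τ) τ)` of the
tableau in which `t i` is the box of the entry `i`. -/
def youngSymmetrizer {n : ℕ} (t : Fin n → ℕ × ℕ) : MonoidAlgebra ℂ (Equiv.Perm (Fin n)) :=
  (∑ σ : Equiv.Perm (Fin n) with ∀ i, (t (σ i)).1 = (t i).1, MonoidAlgebra.single σ (1 : ℂ)) *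
    ∑ τ : Equiv.Perm (Fin n) with ∀ i, (t (τ i)).2 = (t i).2,
      MonoidAlgebra.single τ (((Equiv.Perm.sign τ : ℤˣ) : ℤ) : ℂ)

/-- The Specht module `𝕐_λ`, as the left ideal of `ℂ[S_n]` generated by the Young symmetrizer. -/
def spechtModule {n : ℕ} (t : Fin n → ℕ × ℕ) :
    Submodule (MonoidAlgebra ℂ (Equiv.Perm (Fin n))) (MonoidAlgebra ℂ (Equiv.Perm (Fin n))) :=
  Submodule.span _ {youngSymmetrizer t}

/-- The `𝕐_λ`-isotypic component `𝕐_λ · M` of a representation `M` of `S_n`: the sum of the images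
of the equivariant maps `𝕐_λ → M`, which are the maps `y ↦ y · m` with `m ∈ M`. -/
def isotypicBlock {n : ℕ} {M : Type} [AddCommGroup M] [Module ℂ M]
    (ρ : Representation ℂ (Equiv.Perm (Fin n)) M) (t : Fin n → ℕ × ℕ) : Submodule ℂ M :=
  Submodule.span ℂ {w | ∃ y ∈ spechtModule t, ∃ m : M, w = ρ.asAlgebraHom y m}

/-- The action of `S_j` on the first `j` tensor factors of `(ℂ^k)^{⊗n}`. -/
def permRepFirst {n : ℕ} (k : ℕ) {j : ℕ} (hj : j ≤ n) :
    Representation ℂ (Equiv.Perm (Fin j)) (TensorSpace n k) :=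
  (permRep n k).comp (Equiv.Perm.viaEmbeddingHom (Fin.castLEEmb hj))

/-- The `λ`-block `𝕐_λ ⊗ 𝕌_{k,λ}` of `(ℂ^k)^{⊗n}`, `t` being any standard tableau of shape `λ`. -/
def diagramBlock {n : ℕ} (k : ℕ) {μ : YoungDiagram} (t : StdTableau n μ) :
    Submodule ℂ (TensorSpace n k) :=
  isotypicBlock (permRep n k) t.pos

/-- The subspace `|t⟩ ⊗ 𝕌_{k,λ}` of `(ℂ^k)^{⊗n}` that belongs to the vector `|t⟩` of the
Young (Gelfand–Tsetlin) basis of `𝕐_λ`: for all `j ≤ n`, its vectors belong, with respect to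
`S_j ⊆ S_n`, to the block of the diagram formed by the `j` smallest entries of `t`. -/
def tableauSpace {n : ℕ} (k : ℕ) {μ : YoungDiagram} (t : StdTableau n μ) :
    Submodule ℂ (TensorSpace n k) :=
  ⨅ (j : ℕ) (hj : j ≤ n), isotypicBlock (permRepFirst k hj) (t.pos ∘ Fin.castLE hj)

/-- The representation `𝕌_{k,λ}` of `U(k)` (Weyl's construction): the image of the Young
symmetrizer on `(ℂ^k)^{⊗n}`. -/
def weylModule {n : ℕ} (k : ℕ) {μ : YoungDiagram} (t : StdTableau n μ) :
    Submodule ℂ (TensorSpace n k) :=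
  LinearMap.range ((permRep n k).asAlgebraHom (youngSymmetrizer t.pos))

/-! ### The two diagrams and tableaux -/

/-- The Young diagram `(1^k)`. -/
def colShape (k : ℕ) : YoungDiagram :=
  YoungDiagram.ofRowLens (List.replicate k 1) (List.pairwise_replicate.mpr (by simp)).sortedGE

/-- The Young diagram `(2, 1^{k-2})` (for `k ≥ 2`). -/
def hookShape (k : ℕ) : YoungDiagram :=
  YoungDiagram.ofRowLens (2 :: List.replicate (k - 2) 1) (by
    apply List.Pairwise.sortedGE
    rw [List.pairwise_cons]
    refine ⟨fun a ha => ?_, List.pairwise_replicate.mpr (by simp)⟩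
    rw [List.eq_of_mem_replicate ha]
    norm_num)

theorem mem_colShape {k : ℕ} {c : ℕ × ℕ} : c ∈ colShape k ↔ c.1 < k ∧ c.2 = 0 := by
  simp [colShape, YoungDiagram.mem_ofRowLens]

theorem mem_hookShape {k : ℕ} (hk : 2 ≤ k) {c : ℕ × ℕ} :
    c ∈ hookShape k ↔ (c.1 < k - 1 ∧ c.2 = 0) ∨ c = (0, 1) := by
  obtain ⟨i, j⟩ := c
  simp only [hookShape, YoungDiagram.mem_ofRowLens]
  cases i with
  | zero =>
    simp
    omega
  | succ i =>
    simp
    omega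

/-- The tableau `a`: the entries `1, …, k` fill the only column of `(1^k)`. -/
def colTableau (k : ℕ) : StdTableau k (colShape k) where
  pos i := (i, 0)
  pos_injective i j h := Fin.ext (Prod.ext_iff.mp h).1
  range_pos := by
    ext ⟨i, j⟩
    simp only [Set.mem_range, Set.mem_ofPred_eq, mem_colShape, Prod.mk.injEq]
    constructor
    · rintro ⟨y, rfl, rfl⟩
      exact ⟨y.2, rfl⟩
    · rintro ⟨h, rfl⟩
      exact ⟨⟨i, h⟩, rfl, rfl⟩
  row_increasing i j _ h := absurd h (lt_irrefl _)
  col_increasing i j _ h := h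

/-- The tableau `s` of shape `(2, 1^{k-2})`: the entries `1, …, k - 1` fill the first column and
`k` is the second entry of the first row. -/
def hookTableau {k : ℕ} (hk : 2 ≤ k) : StdTableau k (hookShape k) where
  pos i := if (i : ℕ) < k - 1 then (i, 0) else (0, 1)
  pos_injective i j h := by
    have hi := i.2
    have hj := j.2
    apply Fin.ext
    simp only at h
    split_ifs at h <;> simp at h <;> omega
  range_pos := by
    ext c
    simp only [Set.mem_range, Set.mem_ofPred_eq, mem_hookShape hk]
    constructor
    · rintro ⟨y, rfl⟩
      split_ifs with h
      · exact Or.inl ⟨h, rfl⟩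
      · exact Or.inr rfl
    · rintro (⟨h, h0⟩ | rfl)
      · refine ⟨⟨c.1, by omega⟩, ?_⟩
        simp only [h, if_true]
        exact Prod.ext rfl h0.symm
      · exact ⟨⟨k - 1, by omega⟩, by simp⟩
  row_increasing i j h h' := by
    have hi := i.2
    have hj := j.2
    rw [Fin.lt_def]
    split_ifs at h h' <;> simp at h h' <;> omega
  col_increasing i j h h' := by
    rw [Fin.lt_def]
    split_ifs at h h' <;> simp at h h' <;> omega

/-! ### Dualization and twirling -/

/-- The Levi-Civita symbol `ε_{x₁ … x_k}`. -/
def leviCivita {k : ℕ} (x : Fin k → Fin k) : ℂ :=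
  open Classical in
  if h : Function.Bijective x then
    (((Equiv.Perm.sign (Equiv.ofBijective x h) : ℤˣ) : ℤ) : ℂ) else 0

/-- The slot of Bob's auxiliary `ℂ^k`, the last one of `(ℂ^k)^{⊗k}`; the other `k - 1` slots
are Alice's. -/
def bob {k : ℕ} (hk : 2 ≤ k) : Fin k := ⟨k - 1, by omega⟩

/-- The matrix `ρ_{k,1}` on `(ℂ^k)^{⊗k} ⊗ (ℂ^d ⊗ ℂ^d)` obtained from
`ρ = ∑ |i₀ i₁⟩⟨j₀ j₁| ⊗ ρ_{i₀ i₁, j₀ j₁}` by replacing Alice's `|i₀⟩` with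
`((k-1)!)^{-1/2} ∑_a ε_{a₂ … a_k i₀} |a₂ … a_k⟩`. -/
def dualize {k d : ℕ} (hk : 2 ≤ k)
    (ρ : Matrix ((Fin k × Fin k) × (Fin d × Fin d)) ((Fin k × Fin k) × (Fin d × Fin d)) ℂ) :
    Matrix ((Fin k → Fin k) × (Fin d × Fin d)) ((Fin k → Fin k) × (Fin d × Fin d)) ℂ :=
  Matrix.of fun p q => (((k - 1).factorial : ℕ) : ℂ)⁻¹ * ∑ i₀ : Fin k, ∑ j₀ : Fin k,
    leviCivita (Function.update p.1 (bob hk) i₀) * leviCivita (Function.update q.1 (bob hk) j₀) *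
      ρ ((i₀, p.1 (bob hk)), p.2) ((j₀, q.1 (bob hk)), q.2)

/-- The matrix of `U^{⊗n} ⊗ 1` on `(ℂ^k)^{⊗n} ⊗ (ℂ^d ⊗ ℂ^d)`. -/
def auxUnitary (n d : ℕ) {k : ℕ} (U : UG k) :
    Matrix ((Fin n → Fin k) × (Fin d × Fin d)) ((Fin n → Fin k) × (Fin d × Fin d)) ℂ :=
  tensorPow n (U : Matrix (Fin k) (Fin k) ℂ) ⊗ₖ (1 : Matrix (Fin d × Fin d) (Fin d × Fin d) ℂ)

/-- The twirl `∫_{U(k)} (U^{⊗n} ⊗ 1) σ (U^{⊗n} ⊗ 1)^† dU`, computed entrywise. -/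
def twirl {n k d : ℕ}
    (σ : Matrix ((Fin n → Fin k) × (Fin d × Fin d)) ((Fin n → Fin k) × (Fin d × Fin d)) ℂ) :
    Matrix ((Fin n → Fin k) × (Fin d × Fin d)) ((Fin n → Fin k) × (Fin d × Fin d)) ℂ :=
  Matrix.of fun p q =>
    ∫ U : UG k, (auxUnitary n d U * σ * (auxUnitary n d U).conjTranspose) p q ∂(haarU k)

end Twirl

end

/-! Replacing Alice's factor by the alternating power is the identification of that power with the
dual of `ℂ^k` twisted by the determinant. So `ρ_{k,1}` is supported on the tensors alternating in
the first `k - 1` slots, and this space is a copy of `ℂ^k ⊗ (ℂ^k)^*`, that is, of the `k × k`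
matrices. Under `altEmbed` the action of `U^{⊗k}` becomes `det U` times conjugation by `U`
(`unitaryAct_altEmbed`). Hence the space is the sum of two irreducible pieces: the scalar matrices,
which give the determinant line, and the traceless matrices, of dimension `k² - 1`. Irreducibility
of the latter is proved by hand with diagonal unitaries, permutation matrices and one reflection
(`IsConjInvariant.eq_bot_or_forall_mem`).

These pieces are the two tableau spaces. Alternation in the first `k - 1` slots is the condition
imposed by the truncated tableaux, and vanishing trace is the same as vanishing under the full
antisymmetrizer (`mem_tracelessSpace_iff`). The Young symmetrizer of the hook is explicit, since its
row group has order two (`tableauSpace_hookTableau`). For any other diagram, every slot is avoided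
by two entries of a common row, so antisymmetrizing the remaining slots kills the block. That block
is therefore orthogonal to the support (`isOrtho_diagramBlock`).

The twirl commutes with `U^{⊗k} ⊗ 1`, and its support stays in the alternating space. Each of its
blocks, indexed by two basis vectors of `ℂ^d ⊗ ℂ^d`, is then by Schur's lemma a combination of the
two projectors; the pieces have different dimensions, so there are no cross terms. The coefficients
form two matrices on `ℂ^d ⊗ ℂ^d`. They are positive semidefinite because they are compressions of
the twirl up to a positive factor, and preservation of the trace makes the weights add up to one. -/

noncomputable section

namespace Twirl

variable {k : ℕ}

/-! ### The Levi-Civita symbol -/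

/-- The sign of a permutation as a complex number. -/
def permSign {n : ℕ} (π : Equiv.Perm (Fin n)) : ℂ := (((Equiv.Perm.sign π : ℤˣ) : ℤ) : ℂ)

theorem permSign_mul {n : ℕ} (π σ : Equiv.Perm (Fin n)) :
    permSign (π * σ) = permSign π * permSign σ := by
  simp [permSign]

theorem permSign_mul_self {n : ℕ} (π : Equiv.Perm (Fin n)) : permSign π * permSign π = 1 := by
  rcases Int.units_eq_one_or (Equiv.Perm.sign π) with h | h <;> simp [permSign, h]

theorem permSign_one {n : ℕ} : permSign (1 : Equiv.Perm (Fin n)) = 1 := by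
  simp [permSign]

theorem permSign_swap {n : ℕ} {i j : Fin n} (h : i ≠ j) : permSign (Equiv.swap i j) = -1 := by
  simp [permSign, Equiv.Perm.sign_swap h]

theorem permSign_inv {n : ℕ} (π : Equiv.Perm (Fin n)) : permSign π⁻¹ = permSign π := by
  simp [permSign]

theorem star_permSign {n : ℕ} (π : Equiv.Perm (Fin n)) : star (permSign π) = permSign π := by
  simp [permSign]

theorem leviCivita_perm (σ : Equiv.Perm (Fin k)) : leviCivita (σ : Fin k → Fin k) = permSign σ := by
  rw [leviCivita, dif_pos σ.bijective, permSign]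
  congr 4
  ext
  rfl

theorem leviCivita_of_not_bijective {x : Fin k → Fin k} (h : ¬ Function.Bijective x) :
    leviCivita x = 0 := by
  rw [leviCivita, dif_neg h]

theorem exists_perm_of_bijective {x : Fin k → Fin k} (h : Function.Bijective x) :
    ∃ σ : Equiv.Perm (Fin k), x = σ :=
  ⟨Equiv.ofBijective x h, rfl⟩

theorem leviCivita_comp (x : Fin k → Fin k) (π : Equiv.Perm (Fin k)) :
    leviCivita (x ∘ π) = permSign π * leviCivita x := by
  by_cases h : Function.Bijective x
  · obtain ⟨σ, rfl⟩ := exists_perm_of_bijective h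
    rw [← Equiv.Perm.coe_mul, leviCivita_perm, leviCivita_perm, permSign_mul, mul_comm]
  · rw [leviCivita_of_not_bijective h, leviCivita_of_not_bijective, mul_zero]
    rwa [Equiv.bijective_comp]

theorem star_leviCivita (x : Fin k → Fin k) : star (leviCivita x) = leviCivita x := by
  by_cases h : Function.Bijective x
  · obtain ⟨σ, rfl⟩ := exists_perm_of_bijective h
    rw [leviCivita_perm, star_permSign]
  · rw [leviCivita_of_not_bijective h, star_zero]

/-- Sums weighted by the Levi-Civita symbol run over the permutations only. -/
theorem sum_leviCivita_mul (f : (Fin k → Fin k) → ℂ) :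
    ∑ x, leviCivita x * f x = ∑ σ : Equiv.Perm (Fin k), permSign σ * f σ := by
  symm
  refine Finset.sum_of_injOn (fun σ : Equiv.Perm (Fin k) => (σ : Fin k → Fin k))
    (fun _ _ _ _ h => DFunLike.coe_injective h) (by simp) ?_ ?_
  · intro x _ hx
    rw [leviCivita_of_not_bijective, zero_mul]
    intro h
    obtain ⟨σ, rfl⟩ := exists_perm_of_bijective h
    exact hx ⟨σ, by simp, rfl⟩
  · intro σ _
    rw [leviCivita_perm]

theorem sum_leviCivita_mul_prod (R : Matrix (Fin k) (Fin k) ℂ) :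
    ∑ x, leviCivita x * ∏ s, R s (x s) = R.det := by
  rw [sum_leviCivita_mul, ← Matrix.det_transpose, Matrix.det_apply']
  rfl

/-- The values of `σ` off `b` omit only `σ b`, so this is the one filling of slot `b` that gives a
bijection. -/
theorem leviCivita_update_perm (σ : Equiv.Perm (Fin k)) (b i : Fin k) :
    leviCivita (Function.update σ b i) = if i = σ b then permSign σ else 0 := by
  split_ifs with h
  · rw [h, Function.update_eq_self, leviCivita_perm]
  · apply leviCivita_of_not_bijective
    intro hb
    obtain ⟨j, rfl⟩ := σ.surjective i
    have hj : j ≠ b := fun e => h (by rw [e])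
    apply hj
    apply hb.1
    simp [hj]

/-! ### The tensor power and its two actions -/

theorem permRep_apply {n : ℕ} (π : Equiv.Perm (Fin n)) (v : TensorSpace n k) (x : Fin n → Fin k) :
    permRep n k π v x = v (x ∘ π) := rfl

theorem unitaryAct_apply {n : ℕ} (U : UG k) (v : TensorSpace n k) (x : Fin n → Fin k) :
    unitaryAct n U v x = ∑ y, tensorPow n (U : Matrix (Fin k) (Fin k) ℂ) x y * v y := by
  rfl

theorem tensorPow_one (n : ℕ) : tensorPow n (1 : Matrix (Fin k) (Fin k) ℂ) = 1 := by
  ext x y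
  rw [tensorPow, Matrix.of_apply]
  by_cases h : x = y
  · subst h
    simp
  · rw [Matrix.one_apply_ne h]
    obtain ⟨s, hs⟩ := Function.ne_iff.mp h
    exact Finset.prod_eq_zero (Finset.mem_univ s) (Matrix.one_apply_ne hs)

theorem tensorPow_mul (n : ℕ) (U V : Matrix (Fin k) (Fin k) ℂ) :
    tensorPow n (U * V) = tensorPow n U * tensorPow n V := by
  ext x y
  simp only [tensorPow, Matrix.of_apply, Matrix.mul_apply, Finset.prod_univ_sum,
    Fintype.piFinset_univ, Finset.prod_mul_distrib]

theorem tensorPow_conjTranspose (n : ℕ) (U : Matrix (Fin k) (Fin k) ℂ) :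
    (tensorPow n U).conjTranspose = tensorPow n U.conjTranspose := by
  ext x y
  simp [tensorPow, Matrix.conjTranspose_apply]

theorem tensorPow_comp_perm (n : ℕ) (U : Matrix (Fin k) (Fin k) ℂ) (π : Equiv.Perm (Fin n))
    (x y : Fin n → Fin k) : tensorPow n U (x ∘ π) (y ∘ π) = tensorPow n U x y := by
  simp only [tensorPow, Matrix.of_apply, Function.comp_apply]
  exact Equiv.prod_comp π fun s => U (x s) (y s)

theorem unitaryAct_permRep {n : ℕ} (U : UG k) (π : Equiv.Perm (Fin n)) (v : TensorSpace n k) :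
    unitaryAct n U (permRep n k π v) = permRep n k π (unitaryAct n U v) := by
  ext x
  rw [unitaryAct_apply, permRep_apply, unitaryAct_apply,
    ← Equiv.sum_comp (Equiv.arrowCongr π.symm (Equiv.refl (Fin k)))
      fun y => tensorPow n (U : Matrix (Fin k) (Fin k) ℂ) (x ∘ π) y * v y]
  refine Finset.sum_congr rfl fun y _ => ?_
  rw [permRep_apply, ← tensorPow_comp_perm n _ π x y]
  rfl

theorem unitaryAct_one {n : ℕ} (v : TensorSpace n k) : unitaryAct n (1 : UG k) v = v := by
  ext x
  simp [unitaryAct_apply, tensorPow_one, Matrix.one_apply]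

/-! ### Tensors alternating in all slots but one -/

/-- The map from `ℂ^k ⊗ (ℂ^k)^*` onto the tensors that are alternating in all slots but `b`. -/
def altEmbed (b : Fin k) : Matrix (Fin k) (Fin k) ℂ →ₗ[ℂ] TensorSpace k k where
  toFun Y := WithLp.toLp 2 fun x => ∑ i, leviCivita (Function.update x b i) * Y (x b) i
  map_add' Y Z := by
    ext x
    simp [mul_add, Finset.sum_add_distrib]
  map_smul' c Y := by
    ext x
    simp [Finset.mul_sum, mul_left_comm]

theorem altEmbed_apply (b : Fin k) (Y : Matrix (Fin k) (Fin k) ℂ) (x : Fin k → Fin k) :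
    altEmbed b Y x = ∑ i, leviCivita (Function.update x b i) * Y (x b) i := rfl

/-- The tensors that are alternating in all slots but `b`. -/
def altSpace (b : Fin k) : Submodule ℂ (TensorSpace k k) where
  carrier := {v | ∀ π : Equiv.Perm (Fin k), π b = b → permRep k k π v = permSign π • v}
  add_mem' hv hw π hπ := by rw [map_add, hv π hπ, hw π hπ, smul_add]
  zero_mem' π _ := by rw [map_zero, smul_zero]
  smul_mem' c v hv π hπ := by rw [map_smul, hv π hπ, smul_comm]

theorem update_comp_perm {b : Fin k} {π : Equiv.Perm (Fin k)} (hπ : π b = b) (x : Fin k → Fin k)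
    (i : Fin k) : Function.update (x ∘ π) b i = Function.update x b i ∘ π := by
  funext s
  by_cases hs : s = b
  · subst hs
    simp [hπ]
  · have : π s ≠ b := fun h => hs (π.injective (h.trans hπ.symm))
    simp [hs, this]

theorem altEmbed_mem_altSpace (b : Fin k) (Y : Matrix (Fin k) (Fin k) ℂ) :
    altEmbed b Y ∈ altSpace b := by
  intro π hπ
  ext x
  rw [permRep_apply, altEmbed_apply, PiLp.smul_apply, altEmbed_apply, smul_eq_mul, Finset.mul_sum]
  refine Finset.sum_congr rfl fun i _ => ?_
  rw [update_comp_perm hπ, leviCivita_comp, Function.comp_apply, hπ, mul_assoc]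

/-- Each entry of `Y` appears, up to sign, as a single coordinate of the tensor. Injectivity and
surjectivity of `altEmbed` both rest on this. -/
theorem altEmbed_update_perm (b : Fin k) (Y : Matrix (Fin k) (Fin k) ℂ) (σ : Equiv.Perm (Fin k))
    (j : Fin k) : altEmbed b Y (Function.update σ b j) = permSign σ * Y j (σ b) := by
  simp [altEmbed_apply, leviCivita_update_perm]

theorem altEmbed_perm (b : Fin k) (Y : Matrix (Fin k) (Fin k) ℂ) (σ : Equiv.Perm (Fin k)) :
    altEmbed b Y σ = permSign σ * Y (σ b) (σ b) := by
  conv_lhs => rw [← Function.update_eq_self b (σ : Fin k → Fin k)]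
  exact altEmbed_update_perm b Y σ (σ b)

theorem altEmbed_injective (b : Fin k) : Function.Injective (altEmbed b) := by
  rw [← LinearMap.ker_eq_bot, LinearMap.ker_eq_bot']
  intro Y hY
  ext j i
  have h := altEmbed_update_perm b Y (Equiv.swap b i) j
  rw [hY, Equiv.swap_apply_left] at h
  have h2 : permSign (Equiv.swap b i) ≠ 0 := left_ne_zero_of_mul_eq_one (permSign_mul_self _)
  simpa [h2] using h.symm

/-- A tensor alternating off `b` vanishes when two slots off `b` agree. Otherwise those slots omit
exactly one value `i`, and a permutation fixing `b` brings them to a reference order. The coordinate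
thus depends, up to sign, only on `i` and on the value in slot `b`, which is the data of a matrix.
-/
theorem range_altEmbed (b : Fin k) : LinearMap.range (altEmbed b) = altSpace b := by
  apply le_antisymm
  · rintro _ ⟨Y, rfl⟩
    exact altEmbed_mem_altSpace b Y
  intro v hv
  -- The transposition of `b` and `i` serves as the reference permutation sending `b` to `i`.
  refine ⟨Matrix.of fun j i => permSign (Equiv.swap b i) *
    v (Function.update (Equiv.swap b i) b j), ?_⟩
  ext x
  by_cases hx : ∃ i, Function.Bijective (Function.update x b i)
  · obtain ⟨i, hi⟩ := hx
    obtain ⟨σ, hσ⟩ := exists_perm_of_bijective hi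
    have hσb : σ b = i := by rw [← hσ, Function.update_self]
    have hxσ : x = Function.update σ b (x b) := by rw [← hσ]; simp
    have hfix : ((Equiv.swap b i)⁻¹ * σ) b = b := by simp [hσb]
    have h1 := congrArg (fun w : TensorSpace k k =>
      w (Function.update (Equiv.swap b i) b (x b))) (hv _ hfix)
    simp only [permRep_apply, PiLp.smul_apply, smul_eq_mul] at h1
    have h2 : Function.update (Equiv.swap b i) b (x b) ∘ ((Equiv.swap b i)⁻¹ * σ) = x := by
      rw [← update_comp_perm hfix, ← Equiv.Perm.coe_mul, mul_inv_cancel_left]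
      exact hxσ.symm
    rw [h2] at h1
    rw [h1]
    conv_lhs => rw [hxσ]
    rw [altEmbed_update_perm, Matrix.of_apply, hσb, ← mul_assoc, permSign_mul, permSign_inv,
      mul_comm (permSign σ)]
  · push Not at hx
    have h0 : altEmbed b (Matrix.of fun j i => permSign (Equiv.swap b i) *
        v (Function.update (Equiv.swap b i) b j)) x = 0 := by
      rw [altEmbed_apply]
      exact Finset.sum_eq_zero fun i _ => by rw [leviCivita_of_not_bijective (hx i), zero_mul]
    rw [h0]
    -- If `x` were injective off `b`, it would miss some value there, and putting that value in slot
    -- `b` would give a bijection.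
    have : ∃ s t, s ≠ b ∧ t ≠ b ∧ s ≠ t ∧ x s = x t := by
      by_contra! hcon
      have hinj : Set.InjOn x {s | s ≠ b} := by
        intro s hs t ht hst
        by_contra hne
        exact hcon s t hs ht hne hst
      have : ∃ i, ∀ s, s ≠ b → x s ≠ i := by
        by_contra! hsur
        have hcard : (Finset.univ : Finset (Fin k)).card ≤ (Finset.univ.erase b).card := by
          refine Finset.card_le_card_of_surjOn x ?_
          intro i _
          obtain ⟨s, hs, hsi⟩ := hsur i
          exact ⟨s, by simp [hs], hsi⟩
        have := Finset.card_erase_lt_of_mem (Finset.mem_univ b)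
        omega
      obtain ⟨i, hi⟩ := this
      refine hx i (Finite.injective_iff_bijective.mp ?_)
      intro s t hst
      by_cases hs : s = b <;> by_cases ht : t = b
      · rw [hs, ht]
      · subst hs
        simp [ht] at hst
        exact absurd hst.symm (hi t ht)
      · subst ht
        simp [hs] at hst
        exact absurd hst (hi s hs)
      · simp [hs, ht] at hst
        exact hinj hs ht hst
    obtain ⟨s, t, hs, ht, hst, hxst⟩ := this
    have h1 := congrArg (fun w : TensorSpace k k => w x)
      (hv (Equiv.swap s t) (Equiv.swap_apply_of_ne_of_ne hs.symm ht.symm))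
    simp only [permRep_apply, PiLp.smul_apply, smul_eq_mul, permSign_swap hst] at h1
    have h2 : x ∘ Equiv.swap s t = x := by
      funext r
      by_cases hr : r = s
      · simp [hr, hxst]
      · by_cases hr' : r = t
        · simp [hr', hxst]
        · simp [Equiv.swap_apply_of_ne_of_ne hr hr']
    rw [h2] at h1
    linear_combination (-1 / 2 : ℂ) * h1

/-- Exchanges the value at `b` of a function with a separate value. -/
def exchangeAt (b : Fin k) : (Fin k → Fin k) × Fin k ≃ (Fin k → Fin k) × Fin k :=
  Function.Involutive.toPerm (fun p => (Function.update p.1 b p.2, p.1 b)) (by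
    intro p
    simp)

/-- Exchanging the summation index `i` with the entry of `y` in slot `b` turns the Levi-Civita
factor into `ε_y`. The rest is a product of one entry from each row, where row `b` has become a row
of `U * Y`; the sum is the Leibniz expansion. -/
theorem tensorPow_altEmbed (b : Fin k) (U Y : Matrix (Fin k) (Fin k) ℂ) (x : Fin k → Fin k) :
    ∑ y, tensorPow k U x y * altEmbed b Y y =
      (Matrix.of fun s => if s = b then (U * Y) (x b) else U (x s)).det := by
  rw [← sum_leviCivita_mul_prod]
  simp only [altEmbed_apply, Finset.mul_sum]
  rw [← Fintype.sum_prod_type', ← Equiv.sum_comp (exchangeAt b), Fintype.sum_prod_type]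
  refine Finset.sum_congr rfl fun y _ => ?_
  rw [← Finset.mul_prod_erase _ _ (Finset.mem_univ b)]
  simp only [Matrix.of_apply, if_true, Matrix.mul_apply, Finset.sum_mul, Finset.mul_sum]
  refine Finset.sum_congr rfl fun m _ => ?_
  have hp : ∏ s ∈ Finset.univ.erase b,
      (if s = b then (U * Y) (x b) else U (x s)) (y s) =
      ∏ s ∈ Finset.univ.erase b, U (x s) (y s) :=
    Finset.prod_congr rfl fun s hs => by rw [if_neg (Finset.ne_of_mem_erase hs)]
  have hq : tensorPow k U x (Function.update y b m) =
      U (x b) m * ∏ s ∈ Finset.univ.erase b, U (x s) (y s) := by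
    rw [tensorPow, Matrix.of_apply, ← Finset.mul_prod_erase _ _ (Finset.mem_univ b)]
    congr 1
    · simp
    · exact Finset.prod_congr rfl fun s hs => by
        rw [Function.update_of_ne (Finset.ne_of_mem_erase hs)]
  have hr : exchangeAt b (y, m) = (Function.update y b m, y b) := rfl
  simp only [hr, Function.update_self, Function.update_idem, Function.update_eq_self, hq, hp]
  ring

theorem altEmbed_eq_det (b : Fin k) (Y : Matrix (Fin k) (Fin k) ℂ) (x : Fin k → Fin k) :
    altEmbed b Y x = (Matrix.of fun s => if s = b then Y (x b)
      else (1 : Matrix (Fin k) (Fin k) ℂ) (x s)).det := by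
  have h := tensorPow_altEmbed b 1 Y x
  simpa [tensorPow_one, Matrix.one_apply] using h

/-- Both sides are determinants. The one for `U * Y * star U` has rows of the identity off `b`;
multiplying it on the right by `U` gives the one for the left-hand side and accounts for the factor
`det U`. -/
theorem unitaryAct_altEmbed (b : Fin k) (U : UG k) (Y : Matrix (Fin k) (Fin k) ℂ) :
    unitaryAct k U (altEmbed b Y) = (U : Matrix (Fin k) (Fin k) ℂ).det •
      altEmbed b ((U : Matrix (Fin k) (Fin k) ℂ) * Y *
        star (U : Matrix (Fin k) (Fin k) ℂ)) := by
  ext x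
  rw [unitaryAct_apply, tensorPow_altEmbed, PiLp.smul_apply, altEmbed_eq_det, smul_eq_mul,
    mul_comm, ← Matrix.det_mul]
  congr 1
  have hU : star (U : Matrix (Fin k) (Fin k) ℂ) * (U : Matrix (Fin k) (Fin k) ℂ) = 1 :=
    Matrix.mem_unitaryGroup_iff'.mp U.2
  ext s j
  rw [Matrix.mul_apply]
  simp only [Matrix.of_apply]
  split_ifs with h
  · rw [← Matrix.mul_apply, mul_assoc, hU, mul_one]
  · rw [← Matrix.mul_apply, one_mul]

/-! ### Irreducibility of the adjoint representation of `U(k)` on the traceless matrices -/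

/-- A space of matrices stable under conjugation by unitaries. -/
def IsConjInvariant (S : Submodule ℂ (Matrix (Fin k) (Fin k) ℂ)) : Prop :=
  ∀ U : UG k, ∀ Y ∈ S,
    (U : Matrix (Fin k) (Fin k) ℂ) * Y * star (U : Matrix (Fin k) (Fin k) ℂ) ∈ S

section Conj

variable {S : Submodule ℂ (Matrix (Fin k) (Fin k) ℂ)}

theorem IsConjInvariant.diagonal_mem (hS : IsConjInvariant S) {Y : Matrix (Fin k) (Fin k) ℂ}
    (hY : Y ∈ S) (d : Fin k → ℂ) (hd : ∀ i, d i * star (d i) = 1) :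
    (Matrix.of fun i j => d i * star (d j) * Y i j) ∈ S := by
  have hU : Matrix.diagonal d ∈ Matrix.unitaryGroup (Fin k) ℂ := by
    rw [Matrix.mem_unitaryGroup_iff, Matrix.star_eq_conjTranspose, Matrix.diagonal_conjTranspose,
      Matrix.diagonal_mul_diagonal, ← Matrix.diagonal_one]
    congr 1
    funext i
    exact hd i
  convert hS ⟨_, hU⟩ Y hY using 1
  ext i j
  simp only [Matrix.star_eq_conjTranspose, Matrix.diagonal_conjTranspose, Matrix.of_apply,
    Matrix.mul_diagonal, Matrix.diagonal_mul, Pi.star_apply]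
  ring

/-- Averaging over a few diagonal unitaries isolates an entry. Two sign flips leave only positions
`(p, q)` and `(q, p)`, each multiplied by `4`. A phase `i` at `p` distinguishes these two: the last
step cancels `(q, p)` and doubles `(p, q)`, whence the factor `1 / 8`. -/
theorem IsConjInvariant.single_mem (hS : IsConjInvariant S) {Y : Matrix (Fin k) (Fin k) ℂ}
    (hY : Y ∈ S) {p q : Fin k} (hpq : p ≠ q) : Matrix.single p q (Y p q) ∈ S := by
  have h1 := S.sub_mem hY (hS.diagonal_mem hY (fun i => if i = p then -1 else 1)
    (fun i => by split_ifs <;> simp))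
  have h2 := S.sub_mem h1 (hS.diagonal_mem h1 (fun i => if i = q then -1 else 1)
    (fun i => by split_ifs <;> simp))
  have h3 := S.sub_mem h2 (S.smul_mem Complex.I (hS.diagonal_mem h2
    (fun i => if i = p then Complex.I else 1) (fun i => by split_ifs <;> simp)))
  convert S.smul_mem (1 / 8 : ℂ) h3 using 1
  ext i j
  simp only [Matrix.single_apply, Matrix.smul_apply, Matrix.sub_apply, Matrix.of_apply,
    smul_eq_mul]
  have hI := Complex.I_mul_I
  by_cases hip : i = p
  · subst hip
    by_cases hjq : j = q
    · subst hjq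
      simp [hpq, hpq.symm]
      linear_combination (1 / 2 : ℂ) * Y i j * hI
    · by_cases hji : j = i
      · subst hji
        simp [hpq, hpq.symm]
      · simp [hpq, hjq, hji, Ne.symm hjq]
  · by_cases hjp : j = p
    · subst hjp
      by_cases hiq : i = q
      · subst hiq
        simp [hpq, hpq.symm]
        linear_combination (4 : ℂ) * Y i j * hI
      · simp [hpq, hip, hiq, Ne.symm hip]
    · simp [hip, hjp, Ne.symm hip]

theorem IsConjInvariant.submatrix_mem (hS : IsConjInvariant S) {Y : Matrix (Fin k) (Fin k) ℂ}
    (hY : Y ∈ S) (σ : Equiv.Perm (Fin k)) : Y.submatrix σ σ ∈ S := by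
  have hstar : star ((1 : Matrix (Fin k) (Fin k) ℂ).submatrix σ id) =
      (1 : Matrix (Fin k) (Fin k) ℂ).submatrix id σ := by
    rw [Matrix.star_eq_conjTranspose, Matrix.conjTranspose_submatrix, Matrix.conjTranspose_one]
  have hmul : ∀ Z : Matrix (Fin k) (Fin k) ℂ,
      (1 : Matrix (Fin k) (Fin k) ℂ).submatrix σ id * Z *
        (1 : Matrix (Fin k) (Fin k) ℂ).submatrix id σ = Z.submatrix σ σ := by
    intro Z
    ext i j
    simp [Matrix.mul_apply, Matrix.one_apply]
  have hU : (1 : Matrix (Fin k) (Fin k) ℂ).submatrix σ id ∈ Matrix.unitaryGroup (Fin k) ℂ := by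
    rw [Matrix.mem_unitaryGroup_iff, hstar]
    have := hmul 1
    rw [mul_one] at this
    rw [this, Matrix.submatrix_one_equiv]
  convert hS ⟨_, hU⟩ Y hY using 1
  rw [hstar, hmul]

theorem exists_perm_apply_eq {p q p' q' : Fin k} (h : p ≠ q) (h' : p' ≠ q') :
    ∃ σ : Equiv.Perm (Fin k), σ p' = p ∧ σ q' = q := by
  refine ⟨Equiv.swap (Equiv.swap p' p q') q * Equiv.swap p' p, ?_, ?_⟩
  · rw [Equiv.Perm.mul_apply, Equiv.swap_apply_left]
    apply Equiv.swap_apply_of_ne_of_ne _ h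
    intro e
    apply h'
    apply (Equiv.swap p' p).injective
    rw [← e, Equiv.swap_apply_left]
  · rw [Equiv.Perm.mul_apply, Equiv.swap_apply_left]

theorem IsConjInvariant.single_one_mem (hS : IsConjInvariant S) {p q p' q' : Fin k} (h : p ≠ q)
    (h' : p' ≠ q') (hm : Matrix.single p q (1 : ℂ) ∈ S) : Matrix.single p' q' (1 : ℂ) ∈ S := by
  obtain ⟨σ, rfl, rfl⟩ := exists_perm_apply_eq h h'
  convert hS.submatrix_mem hm σ using 1
  ext i j
  simp [Matrix.single_apply]

/-- A reflection that mixes the basis vectors `p` and `q`. -/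
def mixingReflection (p q : Fin k) : Matrix (Fin k) (Fin k) ℂ :=
  1 - (2 / 5 : ℂ) • Matrix.vecMulVec (Pi.single p 1 + Pi.single q 2)
    (Pi.single p 1 + Pi.single q 2)

theorem star_mixingReflection (p q : Fin k) :
    star (mixingReflection p q) = mixingReflection p q := by
  have h : star (Pi.single p 1 + Pi.single q 2 : Fin k → ℂ) = Pi.single p 1 + Pi.single q 2 := by
    funext i
    simp only [Pi.star_apply, Pi.add_apply, Pi.single_apply]
    split_ifs <;> simp
  rw [mixingReflection, star_sub, star_one, star_smul, Matrix.star_eq_conjTranspose,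
    Matrix.conjTranspose_vecMulVec, h]
  simp

/-- The vector `e_p + 2 e_q` has squared norm `5`, so the factor `2 / 5` makes this a Householder
reflection. The numbers `3, 4, 5` keep all its entries rational. -/
theorem mixingReflection_mem {p q : Fin k} (h : p ≠ q) :
    mixingReflection p q ∈ Matrix.unitaryGroup (Fin k) ℂ := by
  rw [Matrix.mem_unitaryGroup_iff, star_mixingReflection, mixingReflection]
  have hv : Matrix.vecMulVec (Pi.single p 1 + Pi.single q 2 : Fin k → ℂ)
      (Pi.single p 1 + Pi.single q 2) * Matrix.vecMulVec (Pi.single p 1 + Pi.single q 2)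
      (Pi.single p 1 + Pi.single q 2) = (5 : ℂ) • Matrix.vecMulVec
        (Pi.single p 1 + Pi.single q 2) (Pi.single p 1 + Pi.single q 2) := by
    rw [Matrix.vecMulVec_mul_vecMulVec]
    have : (Pi.single p 1 + Pi.single q 2 : Fin k → ℂ) ⬝ᵥ (Pi.single p 1 + Pi.single q 2) = 5 := by
      simp [h, h.symm]
      norm_num
    rw [this]
    ext i j
    simp [Matrix.vecMulVec_apply]
    ring
  rw [sub_mul, mul_sub, one_mul, one_mul, mul_sub, mul_one, smul_mul_assoc, mul_smul_comm, hv]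
  module

theorem mixingReflection_apply_left {p q : Fin k} (h : p ≠ q) (j : Fin k) :
    mixingReflection p q p j = if j = p then 3 / 5 else if j = q then -4 / 5 else 0 := by
  simp only [mixingReflection, Matrix.sub_apply, Matrix.one_apply, Matrix.smul_apply,
    Matrix.vecMulVec_apply, Pi.add_apply, Pi.single_apply, smul_eq_mul, h, if_true, if_false]
  by_cases h1 : j = p
  · subst h1
    simp [h]
    norm_num
  · by_cases h2 : j = q
    · subst h2
      simp [h, h.symm]
      norm_num
    · simp [h1, h2, Ne.symm h1]

theorem mixingReflection_apply_right {p q : Fin k} (h : p ≠ q) (j : Fin k) :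
    mixingReflection p q q j = if j = p then -4 / 5 else if j = q then -3 / 5 else 0 := by
  simp only [mixingReflection, Matrix.sub_apply, Matrix.one_apply, Matrix.smul_apply,
    Matrix.vecMulVec_apply, Pi.add_apply, Pi.single_apply, smul_eq_mul, h.symm, if_true, if_false]
  by_cases h1 : j = p
  · subst h1
    simp [h, h.symm]
    norm_num
  · by_cases h2 : j = q
    · subst h2
      simp [h.symm]
      norm_num
    · simp [h1, h2, Ne.symm h2]

theorem mixingReflection_apply_symm (p q i j : Fin k) :
    mixingReflection p q i j = mixingReflection p q j i := by
  simp only [mixingReflection, Matrix.sub_apply, Matrix.one_apply, Matrix.smul_apply,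
    Matrix.vecMulVec_apply, smul_eq_mul, eq_comm (a := i)]
  ring

/-- The product is the outer product of rows `p` and `q` of the reflection. Its diagonal part is a
nonzero multiple of `E_qq - E_pp`, which is how off-diagonal units produce traceless diagonal
matrices. -/
theorem mixingReflection_mul_single_mul {p q : Fin k} (h : p ≠ q) :
    mixingReflection p q * Matrix.single p q (1 : ℂ) * mixingReflection p q =
      (12 / 25 : ℂ) • (Matrix.single q q (1 : ℂ) - Matrix.single p p 1) -
        (9 / 25 : ℂ) • Matrix.single p q (1 : ℂ) + (16 / 25 : ℂ) • Matrix.single q p (1 : ℂ) := by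
  ext i j
  have h1 : (mixingReflection p q * Matrix.single p q (1 : ℂ) * mixingReflection p q) i j =
      mixingReflection p q p i * mixingReflection p q q j := by
    rw [mixingReflection_apply_symm p q p i, Matrix.mul_apply,
      Finset.sum_eq_single q _ (by simp)]
    · simp
    · intro l _ hl
      simp [hl]
  rw [h1, mixingReflection_apply_left h, mixingReflection_apply_right h]
  simp only [Matrix.add_apply, Matrix.sub_apply, Matrix.smul_apply, Matrix.single_apply,
    smul_eq_mul]
  by_cases hi : i = p <;> by_cases hi' : i = q <;> by_cases hj : j = p <;> by_cases hj' : j = q <;>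
    simp_all [eq_comm] <;> norm_num

theorem IsConjInvariant.single_sub_single_mem (hS : IsConjInvariant S) {p q : Fin k} (h : p ≠ q)
    (hpq : Matrix.single p q (1 : ℂ) ∈ S) (hqp : Matrix.single q p (1 : ℂ) ∈ S) :
    Matrix.single q q (1 : ℂ) - Matrix.single p p 1 ∈ S := by
  have h1 := hS ⟨_, mixingReflection_mem h⟩ _ hpq
  simp only [star_mixingReflection, mixingReflection_mul_single_mul h] at h1
  have h2 := S.smul_mem (25 / 12 : ℂ) (S.sub_mem (S.add_mem h1 (S.smul_mem (9 / 25 : ℂ) hpq))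
    (S.smul_mem (16 / 25 : ℂ) hqp))
  convert h2 using 1
  module

/-- Used in the opposite direction: a diagonal matrix with two different diagonal entries acquires
an off-diagonal entry after conjugation. -/
theorem mixingReflection_mul_mul_apply {p q : Fin k} (h : p ≠ q) (Y : Matrix (Fin k) (Fin k) ℂ)
    (hY : ∀ i j, i ≠ j → Y i j = 0) :
    (mixingReflection p q * Y * mixingReflection p q) p q = (12 / 25 : ℂ) * (Y q q - Y p p) := by
  have hd : Y = Matrix.diagonal fun i => Y i i := by
    ext i j
    by_cases hij : i = j
    · simp [hij]
    · rw [hY i j hij, Matrix.diagonal_apply_ne _ hij]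
  have hsum : (mixingReflection p q * Y * mixingReflection p q) p q =
      ∑ j, mixingReflection p q p j * Y j j * mixingReflection p q j q := by
    rw [hd, Matrix.mul_apply]
    simp [Matrix.mul_diagonal]
  rw [hsum, Finset.sum_eq_add p q h]
  · rw [mixingReflection_apply_left h, mixingReflection_apply_left h,
      mixingReflection_apply_right h]
    simp [h.symm]
    ring
  · rintro j _ ⟨hp, hq⟩
    rw [mixingReflection_apply_left h]
    simp [hp, hq]
  · simp
  · simp

theorem mem_of_single_mem (hoff : ∀ p q : Fin k, p ≠ q → Matrix.single p q (1 : ℂ) ∈ S)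
    (hdiag : ∀ p q : Fin k, p ≠ q → Matrix.single q q (1 : ℂ) - Matrix.single p p 1 ∈ S)
    {Y : Matrix (Fin k) (Fin k) ℂ} (hY : Y.trace = 0) : Y ∈ S := by
  rcases isEmpty_or_nonempty (Fin k) with hk | ⟨⟨o⟩⟩
  · rw [Subsingleton.elim Y 0]
    exact S.zero_mem
  -- The subtracted terms add up to the trace of `Y` times `E_oo`, which is zero.
  have hdec : Y = ∑ i, ∑ j, Y i j • (Matrix.single i j (1 : ℂ) -
      if i = j then Matrix.single o o 1 else 0) := by
    simp only [smul_sub, Finset.sum_sub_distrib, smul_ite, smul_zero, Finset.sum_ite_eq,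
      Finset.mem_univ, if_true, ← Finset.sum_smul]
    have : ∑ i, Y i i = 0 := hY
    rw [this, zero_smul, sub_zero]
    conv_lhs => rw [Matrix.matrix_eq_sum_single Y]
    simp
  rw [hdec]
  refine S.sum_mem fun i _ => S.sum_mem fun j _ => S.smul_mem _ ?_
  split_ifs with hij
  · subst hij
    by_cases hio : o = i
    · subst hio
      simp
    · exact hdiag o i hio
  · rw [sub_zero]
    exact hoff i j hij

/-- A nonzero conjugation-invariant space of traceless matrices contains all of them. -/
theorem IsConjInvariant.eq_bot_or_forall_mem (hS : IsConjInvariant S)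
    (htr : ∀ Y ∈ S, Y.trace = 0) : S = ⊥ ∨ ∀ Y : Matrix (Fin k) (Fin k) ℂ, Y.trace = 0 → Y ∈ S := by
  -- One nonzero off-diagonal entry generates all the matrix units and hence everything traceless.
  -- If there is none, all elements of `S` are diagonal, then scalar by conjugation with
  -- reflections, then zero by the trace.
  by_cases hoff : ∃ Y ∈ S, ∃ p q, p ≠ q ∧ Y p q ≠ 0
  · right
    obtain ⟨Y, hY, p, q, hpq, hne⟩ := hoff
    have h1 : Matrix.single p q (1 : ℂ) ∈ S := by
      have := S.smul_mem (Y p q)⁻¹ (hS.single_mem hY hpq)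
      rwa [Matrix.smul_single, smul_eq_mul, inv_mul_cancel₀ hne] at this
    have h2 : ∀ p q : Fin k, p ≠ q → Matrix.single p q (1 : ℂ) ∈ S :=
      fun p' q' h' => hS.single_one_mem hpq h' h1
    intro Z hZ
    exact mem_of_single_mem h2
      (fun p q h => hS.single_sub_single_mem h (h2 p q h) (h2 q p h.symm)) hZ
  · left
    push Not at hoff
    rw [Submodule.eq_bot_iff]
    intro Y hY
    have hdiag : ∀ p q, Y p p = Y q q := by
      intro p q
      by_cases hpq : p = q
      · rw [hpq]
      have h1 := hoff _ (hS ⟨_, mixingReflection_mem hpq⟩ _ hY) p q hpq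
      simp only [star_mixingReflection, mixingReflection_mul_mul_apply hpq Y (hoff Y hY)] at h1
      linear_combination (-25 / 12 : ℂ) * h1
    ext i j
    by_cases hij : i = j
    · subst hij
      have h1 : (k : ℂ) * Y i i = 0 := by
        rw [← htr Y hY, Matrix.trace]
        simp [Matrix.diag, fun j => hdiag j i]
      have hk : (k : ℂ) ≠ 0 := by
        have := i.pos
        exact_mod_cast this.ne'
      simpa [hk] using h1
    · exact hoff Y hY i j hij

end Conj

/-! ### Counting permutations with one prescribed value -/

theorem card_filter_perm_apply_eq (b i : Fin k) :
    (Finset.univ.filter fun σ : Equiv.Perm (Fin k) => σ b = i).card = (k - 1).factorial := by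
  -- Left multiplication by a transposition identifies the fibres of evaluation at `b`; there are
  -- `k` of them in a set of size `k!`.
  have hconst : ∀ j : Fin k, (Finset.univ.filter fun σ : Equiv.Perm (Fin k) => σ b = j).card =
      (Finset.univ.filter fun σ : Equiv.Perm (Fin k) => σ b = i).card := by
    intro j
    refine Finset.card_bij' (fun σ _ => Equiv.swap i j * σ) (fun σ _ => Equiv.swap i j * σ)
      ?_ ?_ ?_ ?_
    · intro σ hσ
      simp_all
    · intro σ hσ
      simp_all
    · intro σ _
      simp [← mul_assoc]
    · intro σ _
      simp [← mul_assoc]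
  have h := Finset.card_eq_sum_card_fiberwise (s := (Finset.univ : Finset (Equiv.Perm (Fin k))))
    (t := Finset.univ) (f := fun σ => σ b) (by simp)
  simp only [hconst, Finset.sum_const, Finset.card_univ, Fintype.card_perm, Fintype.card_fin,
    smul_eq_mul] at h
  have hk : 0 < k := b.pos
  rw [← Nat.mul_factorial_pred hk.ne'] at h
  exact (Nat.eq_of_mul_eq_mul_left hk h).symm

theorem sum_perm_apply (b : Fin k) (f : Fin k → ℂ) :
    ∑ σ : Equiv.Perm (Fin k), f (σ b) = ((k - 1).factorial : ℂ) * ∑ i, f i := by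
  rw [← Finset.sum_fiberwise Finset.univ (fun σ : Equiv.Perm (Fin k) => σ b), Finset.mul_sum]
  refine Finset.sum_congr rfl fun i _ => ?_
  rw [Finset.sum_congr rfl (g := fun _ => f i) fun σ hσ => by rw [(Finset.mem_filter.mp hσ).2],
    Finset.sum_const, card_filter_perm_apply_eq, nsmul_eq_mul]

/-! ### The determinant line and the traceless part -/

/-- The alternating tensor whose coordinates are the Levi-Civita symbols. -/
def detVector (k : ℕ) : TensorSpace k k := WithLp.toLp 2 leviCivita

theorem detVector_apply (x : Fin k → Fin k) : detVector k x = leviCivita x := rfl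

theorem altEmbed_one (b : Fin k) : altEmbed b 1 = detVector k := by
  ext x
  simp [altEmbed_apply, detVector_apply, Matrix.one_apply]

theorem detVector_ne_zero : detVector k ≠ 0 := by
  intro h
  have h1 := congrArg (fun v : TensorSpace k k => v (1 : Equiv.Perm (Fin k))) h
  rw [detVector_apply, leviCivita_perm, permSign_one] at h1
  exact one_ne_zero h1

theorem permRep_detVector (π : Equiv.Perm (Fin k)) :
    permRep k k π (detVector k) = permSign π • detVector k := by
  ext x
  rw [permRep_apply, detVector_apply, leviCivita_comp, PiLp.smul_apply, detVector_apply,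
    smul_eq_mul]

/-- A tensor alternating in all `k` slots is a multiple of `detVector`. -/
theorem eq_smul_detVector {v : TensorSpace k k}
    (hv : ∀ π : Equiv.Perm (Fin k), permRep k k π v = permSign π • v) :
    v = v id • detVector k := by
  ext x
  rw [PiLp.smul_apply, detVector_apply, smul_eq_mul]
  by_cases hx : Function.Bijective x
  · obtain ⟨σ, rfl⟩ := exists_perm_of_bijective hx
    have h := congrArg (fun w : TensorSpace k k => w id) (hv σ)
    simp only [permRep_apply, Function.id_comp, PiLp.smul_apply, smul_eq_mul] at h
    rw [h, leviCivita_perm, mul_comm]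
  · rw [leviCivita_of_not_bijective hx, mul_zero]
    rw [← Finite.injective_iff_bijective] at hx
    simp only [Function.Injective] at hx
    push Not at hx
    obtain ⟨s, t, hxst, hst⟩ := hx
    have h1 := congrArg (fun w : TensorSpace k k => w x) (hv (Equiv.swap s t))
    simp only [permRep_apply, PiLp.smul_apply, smul_eq_mul, permSign_swap hst] at h1
    have h2 : x ∘ Equiv.swap s t = x := by
      funext r
      by_cases hr : r = s
      · simp [hr, hxst]
      · by_cases hr' : r = t
        · simp [hr', hxst]
        · simp [Equiv.swap_apply_of_ne_of_ne hr hr']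
    rw [h2] at h1
    linear_combination (1 / 2 : ℂ) * h1

/-- The image of the traceless matrices among the tensors alternating in all slots but `b`. -/
def tracelessSpace (b : Fin k) : Submodule ℂ (TensorSpace k k) :=
  (LinearMap.ker (Matrix.traceLinearMap (Fin k) ℂ ℂ)).map (altEmbed b)

theorem altEmbed_mem_tracelessSpace {b : Fin k} {Y : Matrix (Fin k) (Fin k) ℂ} :
    altEmbed b Y ∈ tracelessSpace b ↔ Y.trace = 0 := by
  constructor
  · rintro ⟨Z, hZ, h⟩
    rw [← altEmbed_injective b h]
    exact hZ
  · exact fun h => ⟨Y, h, rfl⟩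

theorem exists_of_mem_tracelessSpace {b : Fin k} {v : TensorSpace k k}
    (hv : v ∈ tracelessSpace b) : ∃ Y, Y.trace = 0 ∧ altEmbed b Y = v := by
  obtain ⟨Y, hY, rfl⟩ := hv
  exact ⟨Y, hY, rfl⟩

theorem tracelessSpace_le_altSpace (b : Fin k) : tracelessSpace b ≤ altSpace b := by
  intro v hv
  obtain ⟨Y, _, rfl⟩ := exists_of_mem_tracelessSpace hv
  exact altEmbed_mem_altSpace b Y

theorem trace_conj (U : UG k) (Y : Matrix (Fin k) (Fin k) ℂ) :
    ((U : Matrix (Fin k) (Fin k) ℂ) * Y * star (U : Matrix (Fin k) (Fin k) ℂ)).trace =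
      Y.trace := by
  rw [Matrix.trace_mul_comm, ← mul_assoc, Matrix.mem_unitaryGroup_iff'.mp U.2, one_mul]

theorem isInvariant_tracelessSpace (b : Fin k) : IsInvariant (tracelessSpace b) := by
  intro U v hv
  obtain ⟨Y, hY, rfl⟩ := exists_of_mem_tracelessSpace hv
  rw [unitaryAct_altEmbed]
  refine Submodule.smul_mem _ _ (altEmbed_mem_tracelessSpace.mpr ?_)
  rw [trace_conj, hY]

theorem isInvariant_altSpace (b : Fin k) : IsInvariant (altSpace b) := by
  intro U v hv π hπ
  rw [← unitaryAct_permRep, hv π hπ, map_smul]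

theorem unitaryAct_detVector (U : UG k) :
    unitaryAct k U (detVector k) = (U : Matrix (Fin k) (Fin k) ℂ).det • detVector k := by
  rcases isEmpty_or_nonempty (Fin k) with hk | ⟨⟨b⟩⟩
  · obtain rfl : k = 0 := by
      by_contra h
      exact hk.false ⟨0, Nat.pos_of_ne_zero h⟩
    rw [Subsingleton.elim U 1, unitaryAct_one]
    simp
  · rw [← altEmbed_one b, unitaryAct_altEmbed, mul_one, Matrix.mem_unitaryGroup_iff.mp U.2]

theorem finrank_tracelessSpace (b : Fin k) :
    Module.finrank ℂ (tracelessSpace b) = k ^ 2 - 1 := by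
  have h1 := (Submodule.equivMapOfInjective (altEmbed b) (altEmbed_injective b)
    (LinearMap.ker (Matrix.traceLinearMap (Fin k) ℂ ℂ))).finrank_eq
  have h2 := LinearMap.finrank_range_add_finrank_ker (Matrix.traceLinearMap (Fin k) ℂ ℂ)
  have h3 : LinearMap.range (Matrix.traceLinearMap (Fin k) ℂ ℂ) = ⊤ := by
    rw [LinearMap.range_eq_top]
    intro c
    exact ⟨Matrix.single b b c, by simp⟩
  rw [h3, finrank_top, Module.finrank_self, Module.finrank_matrix, Module.finrank_self,
    Fintype.card_fin] at h2
  rw [tracelessSpace, ← h1, pow_two]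
  omega

theorem one_lt_finrank_tracelessSpace (hk : 2 ≤ k) (b : Fin k) :
    1 < Module.finrank ℂ (tracelessSpace b) := by
  rw [finrank_tracelessSpace]
  have := Nat.pow_le_pow_left hk 2
  omega

/-- Pulled back along `altEmbed`, an invariant subspace becomes a conjugation-invariant space of
traceless matrices, since the factor `det U` is nonzero and can be dropped. -/
theorem isIrreducible_tracelessSpace (hk : 2 ≤ k) (b : Fin k) :
    IsIrreducible (tracelessSpace b) := by
  refine ⟨isInvariant_tracelessSpace b, ?_, ?_⟩
  · intro h
    have := one_lt_finrank_tracelessSpace hk b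
    rw [h, finrank_bot] at this
    omega
  · intro W hW hinv
    have hS : IsConjInvariant (W.comap (altEmbed b)) := by
      intro U Y hY
      have h1 := hinv U _ hY
      rw [unitaryAct_altEmbed] at h1
      have hdet : (U : Matrix (Fin k) (Fin k) ℂ).det ≠ 0 := by
        have := congrArg Matrix.det (Matrix.mem_unitaryGroup_iff.mp U.2)
        rw [Matrix.det_mul, Matrix.det_one] at this
        exact left_ne_zero_of_mul_eq_one this
      exact (W.smul_mem_iff hdet).mp h1
    rcases hS.eq_bot_or_forall_mem
      (fun Y hY => altEmbed_mem_tracelessSpace.mp (hW hY)) with h | h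
    · left
      rw [Submodule.eq_bot_iff]
      intro v hv
      obtain ⟨Y, _, rfl⟩ := exists_of_mem_tracelessSpace (hW hv)
      have : Y ∈ W.comap (altEmbed b) := hv
      rw [h, Submodule.mem_bot] at this
      rw [this, map_zero]
    · right
      apply le_antisymm hW
      intro v hv
      obtain ⟨Y, hY, rfl⟩ := exists_of_mem_tracelessSpace hv
      exact h Y hY

/-- Only permutations contribute, the two signs cancel, and each value of `σ b` occurs `(k - 1)!`
times. -/
theorem inner_detVector_altEmbed (b : Fin k) (Y : Matrix (Fin k) (Fin k) ℂ) :
    inner ℂ (detVector k) (altEmbed b Y) = ((k - 1).factorial : ℂ) * Y.trace := by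
  have h : inner ℂ (detVector k) (altEmbed b Y) = ∑ x, leviCivita x * altEmbed b Y x := by
    rw [PiLp.inner_apply]
    refine Finset.sum_congr rfl fun x _ => ?_
    rw [RCLike.inner_apply, detVector_apply, mul_comm]
    congr 1
    exact star_leviCivita x
  rw [h, sum_leviCivita_mul]
  simp only [altEmbed_perm, ← mul_assoc, permSign_mul_self, one_mul]
  exact sum_perm_apply b fun i => Y i i

theorem isOrtho_span_detVector_tracelessSpace (b : Fin k) :
    Submodule.span ℂ {detVector k} ⟂ tracelessSpace b := by
  rw [Submodule.isOrtho_iff_inner_eq]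
  intro u hu v hv
  obtain ⟨c, rfl⟩ := Submodule.mem_span_singleton.mp hu
  obtain ⟨Y, hY, rfl⟩ := exists_of_mem_tracelessSpace hv
  rw [inner_smul_left, inner_detVector_altEmbed, hY, mul_zero, mul_zero]

/-- The decomposition of the space of tensors alternating in all slots but one. -/
theorem exists_add_of_mem_altSpace {b : Fin k} {v : TensorSpace k k} (hv : v ∈ altSpace b) :
    ∃ c : ℂ, ∃ w ∈ tracelessSpace b, v = c • detVector k + w := by
  rw [← range_altEmbed] at hv
  obtain ⟨Y, rfl⟩ := hv
  have hk : (k : ℂ) ≠ 0 := by exact_mod_cast b.pos.ne'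
  refine ⟨Y.trace / k, altEmbed b (Y - (Y.trace / k) • 1), altEmbed_mem_tracelessSpace.mpr ?_, ?_⟩
  · rw [Matrix.trace_sub, Matrix.trace_smul, Matrix.trace_one, Fintype.card_fin, smul_eq_mul,
      div_mul_cancel₀ _ hk, sub_self]
  · rw [map_sub, map_smul, altEmbed_one, add_sub_cancel]

/-! ### Antisymmetrizers -/

/-- The signed sum over all permutations of the slots. -/
def fullAlt (k : ℕ) : TensorSpace k k →ₗ[ℂ] TensorSpace k k :=
  ∑ π : Equiv.Perm (Fin k), permSign π • permRep k k π

/-- The signed sum over the permutations of the slots other than `b`. -/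
def slotAlt (b : Fin k) : TensorSpace k k →ₗ[ℂ] TensorSpace k k :=
  ∑ π : Equiv.Perm (Fin k) with π b = b, permSign π • permRep k k π

theorem fullAlt_apply (v : TensorSpace k k) :
    fullAlt k v = ∑ π : Equiv.Perm (Fin k), permSign π • permRep k k π v := by
  simp [fullAlt]

theorem slotAlt_apply (b : Fin k) (v : TensorSpace k k) :
    slotAlt b v = ∑ π : Equiv.Perm (Fin k) with π b = b, permSign π • permRep k k π v := by
  simp [slotAlt]

theorem permRep_mul_apply {n : ℕ} (π σ : Equiv.Perm (Fin n)) (v : TensorSpace n k) :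
    permRep n k (π * σ) v = permRep n k π (permRep n k σ v) := rfl

theorem permRep_slotAlt {b : Fin k} {π : Equiv.Perm (Fin k)} (hπ : π b = b)
    (v : TensorSpace k k) : permRep k k π (slotAlt b v) = permSign π • slotAlt b v := by
  rw [slotAlt_apply, map_sum, Finset.smul_sum]
  refine Finset.sum_bij' (fun σ _ => π * σ) (fun σ _ => π⁻¹ * σ) ?_ ?_ ?_ ?_ ?_
  · intro σ hσ
    simp_all
  · intro σ hσ
    have : π⁻¹ b = b := by rw [Equiv.Perm.inv_eq_iff_eq, hπ]
    simp_all
  · simp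
  · simp
  · intro σ _
    rw [map_smul, permRep_mul_apply, smul_smul, permSign_mul, ← mul_assoc, permSign_mul_self,
      one_mul]

theorem slotAlt_mem_altSpace (b : Fin k) (v : TensorSpace k k) : slotAlt b v ∈ altSpace b :=
  fun _ hπ => permRep_slotAlt hπ v

theorem slotAlt_permRep {b : Fin k} {π : Equiv.Perm (Fin k)} (hπ : π b = b)
    (v : TensorSpace k k) : slotAlt b (permRep k k π v) = permSign π • slotAlt b v := by
  rw [slotAlt_apply, slotAlt_apply, Finset.smul_sum]
  refine Finset.sum_bij' (fun σ _ => σ * π) (fun σ _ => σ * π⁻¹) ?_ ?_ ?_ ?_ ?_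
  · intro σ hσ
    simp_all
  · intro σ hσ
    have : π⁻¹ b = b := by rw [Equiv.Perm.inv_eq_iff_eq, hπ]
    simp_all
  · simp
  · simp
  · intro σ _
    rw [permRep_mul_apply, smul_smul, permSign_mul, mul_comm (permSign σ), ← mul_assoc,
      permSign_mul_self, one_mul]

theorem slotAlt_of_mem {b : Fin k} {v : TensorSpace k k} (hv : v ∈ altSpace b) :
    slotAlt b v = ((k - 1).factorial : ℂ) • v := by
  rw [slotAlt_apply, Finset.sum_congr rfl (g := fun _ => v), Finset.sum_const,
    card_filter_perm_apply_eq, Nat.cast_smul_eq_nsmul]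
  intro π hπ
  rw [hv π (Finset.mem_filter.mp hπ).2, smul_smul, permSign_mul_self, one_smul]

theorem permRep_fullAlt (π : Equiv.Perm (Fin k)) (v : TensorSpace k k) :
    permRep k k π (fullAlt k v) = permSign π • fullAlt k v := by
  rw [fullAlt_apply, map_sum, Finset.smul_sum, ← Equiv.sum_comp (Equiv.mulLeft π)
    fun σ => permSign π • permSign σ • permRep k k σ v]
  refine Finset.sum_congr rfl fun σ _ => ?_
  rw [Equiv.coe_mulLeft, map_smul, permRep_mul_apply, smul_smul, permSign_mul, ← mul_assoc,
    permSign_mul_self, one_mul]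

theorem fullAlt_permRep (π : Equiv.Perm (Fin k)) (v : TensorSpace k k) :
    fullAlt k (permRep k k π v) = permSign π • fullAlt k v := by
  rw [fullAlt_apply, fullAlt_apply, Finset.smul_sum, ← Equiv.sum_comp (Equiv.mulRight π)
    fun σ => permSign π • permSign σ • permRep k k σ v]
  refine Finset.sum_congr rfl fun σ _ => ?_
  rw [Equiv.coe_mulRight, permRep_mul_apply, smul_smul, permSign_mul, mul_comm (permSign σ),
    ← mul_assoc, permSign_mul_self, one_mul]

theorem fullAlt_altEmbed (b : Fin k) (Y : Matrix (Fin k) (Fin k) ℂ) :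
    fullAlt k (altEmbed b Y) = (((k - 1).factorial : ℂ) * Y.trace) • detVector k := by
  rw [eq_smul_detVector fun π => permRep_fullAlt π (altEmbed b Y)]
  congr 1
  rw [fullAlt_apply]
  have h : ∀ π : Equiv.Perm (Fin k), (permSign π • permRep k k π (altEmbed b Y)) id =
      Y (π b) (π b) := by
    intro π
    rw [PiLp.smul_apply, permRep_apply, Function.id_comp, altEmbed_perm, smul_eq_mul, ← mul_assoc,
      permSign_mul_self, one_mul]
  rw [WithLp.ofLp_sum, Finset.sum_apply, Finset.sum_congr rfl fun π _ => h π]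
  exact sum_perm_apply b fun i => Y i i

/-- Full antisymmetrization of `altEmbed b Y` returns a nonzero multiple of the trace of `Y`. The
traceless part is thereby described through `S_k` alone, which makes it comparable with Young
symmetrizers. -/
theorem mem_tracelessSpace_iff {b : Fin k} {v : TensorSpace k k} :
    v ∈ tracelessSpace b ↔ v ∈ altSpace b ∧ fullAlt k v = 0 := by
  constructor
  · intro hv
    refine ⟨tracelessSpace_le_altSpace b hv, ?_⟩
    obtain ⟨Y, hY, rfl⟩ := exists_of_mem_tracelessSpace hv
    rw [fullAlt_altEmbed, hY, mul_zero, zero_smul]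
  · rintro ⟨hv, h0⟩
    rw [← range_altEmbed] at hv
    obtain ⟨Y, rfl⟩ := hv
    rw [fullAlt_altEmbed] at h0
    have := (smul_eq_zero.mp h0).resolve_right detVector_ne_zero
    refine altEmbed_mem_tracelessSpace.mpr ((mul_eq_zero.mp this).resolve_left ?_)
    exact_mod_cast (Nat.factorial_pos _).ne'

/-- `S_k` is split into cosets of the stabilizer of `b` according to `π⁻¹ b`. The trivial coset
gives the first term. The other `k - 1` cosets all contribute the same: their transpositions `(i b)`
are conjugate to `(o b)` under elements fixing `b`, whose signs cancel in pairs. -/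
theorem fullAlt_of_mem_altSpace {o b : Fin k} (hob : o ≠ b) {v : TensorSpace k k}
    (hv : v ∈ altSpace b) :
    fullAlt k v = slotAlt b v - ((k : ℂ) - 1) • slotAlt b (permRep k k (Equiv.swap o b) v) := by
  have hcoset : ∀ i : Fin k, ∑ π : Equiv.Perm (Fin k) with π i = b,
      permSign π • permRep k k π v =
      permSign (Equiv.swap i b) • slotAlt b (permRep k k (Equiv.swap i b) v) := by
    intro i
    rw [slotAlt_apply, Finset.smul_sum]
    refine Finset.sum_bij' (fun σ _ => σ * Equiv.swap i b) (fun σ _ => σ * Equiv.swap i b)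
      ?_ ?_ ?_ ?_ ?_
    · intro σ hσ
      simp_all
    · intro σ hσ
      simp_all
    · simp [mul_assoc]
    · simp [mul_assoc]
    · intro σ _
      rw [← permRep_mul_apply, mul_assoc, Equiv.swap_mul_self, mul_one, smul_smul, permSign_mul,
        mul_comm, mul_assoc, permSign_mul_self, mul_one]
  have hne : ∀ i : Fin k, i ≠ b → permSign (Equiv.swap i b) •
      slotAlt b (permRep k k (Equiv.swap i b) v) =
      -slotAlt b (permRep k k (Equiv.swap o b) v) := by
    intro i hi
    rw [permSign_swap hi, neg_one_smul, neg_inj]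
    by_cases hio : i = o
    · rw [hio]
    have hfix : Equiv.swap o i b = b := Equiv.swap_apply_of_ne_of_ne hob.symm (Ne.symm hi)
    have hconj : Equiv.swap i b = Equiv.swap o i * Equiv.swap o b * Equiv.swap o i := by
      have := Equiv.swap_mul_swap_mul_swap (x := b) (y := o) (z := i) hob.symm (Ne.symm hi)
      rw [Equiv.swap_comm o i, Equiv.swap_comm o b]
      rw [Equiv.swap_comm i o, this]
    rw [hconj, mul_assoc, permRep_mul_apply, permRep_mul_apply, slotAlt_permRep hfix,
      hv _ hfix, map_smul, map_smul, smul_smul, permSign_mul_self, one_smul]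
  rw [fullAlt_apply, ← Finset.sum_fiberwise Finset.univ
    (fun π : Equiv.Perm (Fin k) => π⁻¹ b)]
  have hfib : ∀ i : Fin k, ∑ π : Equiv.Perm (Fin k) with π⁻¹ b = i,
      permSign π • permRep k k π v = ∑ π : Equiv.Perm (Fin k) with π i = b,
      permSign π • permRep k k π v := by
    intro i
    refine Finset.sum_congr ?_ fun _ _ => rfl
    ext π
    rw [Finset.mem_filter, Finset.mem_filter, Equiv.Perm.inv_eq_iff_eq, eq_comm (a := b)]
  rw [Finset.sum_congr rfl fun i _ => (hfib i).trans (hcoset i),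
    ← Finset.add_sum_erase _ _ (Finset.mem_univ b),
    Finset.sum_congr rfl fun i hi => hne i (Finset.ne_of_mem_erase hi)]
  rw [Finset.sum_const, Finset.card_erase_of_mem (Finset.mem_univ b), Finset.card_univ,
    Fintype.card_fin, Equiv.swap_self, ← Nat.cast_smul_eq_nsmul ℂ, Nat.cast_sub b.pos, smul_neg,
    ← sub_eq_add_neg, Nat.cast_one]
  congr 1
  change permSign (1 : Equiv.Perm (Fin k)) • slotAlt b v = _
  rw [permSign_one, one_smul]

/-- On the traceless part the full antisymmetrizer vanishes, so the coset formula evaluates the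
swapped term as `(k - 1)! / (k - 1)` times `v`. Consequently `slotAlt` undoes, up to a scalar, the
row symmetrizer `1 + (o b)` of the hook. -/
theorem exists_slotAlt_add_swap {o b : Fin k} (hob : o ≠ b) :
    ∃ c : ℂ, c ≠ 0 ∧ ∀ v ∈ tracelessSpace b,
      slotAlt b (v + permRep k k (Equiv.swap o b) v) = c • v := by
  have hk : 2 ≤ k := by
    have h1 := o.2
    have h2 := b.2
    have h3 : (o : ℕ) ≠ b := fun h => hob (Fin.ext h)
    omega
  have hk1 : ((k : ℂ) - 1) ≠ 0 := by
    rw [sub_ne_zero]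
    exact_mod_cast (by omega : k ≠ 1)
  refine ⟨((k - 1).factorial : ℂ) * (k / (k - 1)), ?_, ?_⟩
  · refine mul_ne_zero (by exact_mod_cast (Nat.factorial_pos _).ne') (div_ne_zero ?_ hk1)
    exact_mod_cast (by omega : k ≠ 0)
  · intro v hv
    obtain ⟨h1, h2⟩ := mem_tracelessSpace_iff.mp hv
    rw [fullAlt_of_mem_altSpace hob h1, slotAlt_of_mem h1, sub_eq_zero] at h2
    have h3 : slotAlt b (permRep k k (Equiv.swap o b) v) =
        ((k : ℂ) - 1)⁻¹ • ((k - 1).factorial : ℂ) • v := by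
      rw [h2, smul_smul, inv_mul_cancel₀ hk1, one_smul]
    rw [map_add, slotAlt_of_mem h1, h3, smul_smul, ← add_smul]
    congr 1
    field_simp
    ring

/-! ### Isotypic blocks -/

section Isotypic

variable {n : ℕ} {M : Type} [AddCommGroup M] [Module ℂ M]
  (ρ : Representation ℂ (Equiv.Perm (Fin n)) M)

theorem asAlgebraHom_mem {N : Submodule ℂ M} (hN : ∀ π, ∀ v ∈ N, ρ π v ∈ N)
    (y : MonoidAlgebra ℂ (Equiv.Perm (Fin n))) {v : M} (hv : v ∈ N) :
    ρ.asAlgebraHom y v ∈ N := by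
  induction y using MonoidAlgebra.induction_on with
  | of π => simpa using hN π v hv
  | add a b ha hb =>
    rw [map_add, LinearMap.add_apply]
    exact N.add_mem ha hb
  | smul c a ha =>
    rw [map_smul, LinearMap.smul_apply]
    exact N.smul_mem c ha

theorem asAlgebraHom_mem_isotypicBlock (t : Fin n → ℕ × ℕ)
    (y : MonoidAlgebra ℂ (Equiv.Perm (Fin n))) (m : M) :
    ρ.asAlgebraHom y (ρ.asAlgebraHom (youngSymmetrizer t) m) ∈ isotypicBlock ρ t := by
  refine Submodule.subset_span ⟨y * youngSymmetrizer t, ?_, m, ?_⟩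
  · exact Submodule.smul_mem _ y (Submodule.mem_span_singleton_self _)
  · rw [map_mul, Module.End.mul_apply]

/-- The Specht module is generated as a left ideal by the Young symmetrizer, so a stable subspace
need only be tested on images of that one element. -/
theorem isotypicBlock_le {t : Fin n → ℕ × ℕ} {N : Submodule ℂ M}
    (hN : ∀ π, ∀ v ∈ N, ρ π v ∈ N) (h : ∀ m, ρ.asAlgebraHom (youngSymmetrizer t) m ∈ N) :
    isotypicBlock ρ t ≤ N := by
  refine Submodule.span_le.mpr ?_
  rintro _ ⟨y, hy, m, rfl⟩
  obtain ⟨z, rfl⟩ := Submodule.mem_span_singleton.mp hy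
  rw [smul_eq_mul, map_mul, Module.End.mul_apply]
  exact asAlgebraHom_mem ρ hN z (h m)

theorem asAlgebraHom_youngSymmetrizer (t : Fin n → ℕ × ℕ) (m : M) :
    ρ.asAlgebraHom (youngSymmetrizer t) m =
      ∑ σ : Equiv.Perm (Fin n) with ∀ i, (t (σ i)).1 = (t i).1,
        ρ σ (∑ τ : Equiv.Perm (Fin n) with ∀ i, (t (τ i)).2 = (t i).2, permSign τ • ρ τ m) := by
  simp only [youngSymmetrizer, map_mul, map_sum, Module.End.mul_apply, LinearMap.sum_apply,
    Representation.asAlgebraHom_single, one_smul, LinearMap.smul_apply, permSign]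
  exact Finset.sum_comm

/-- For a tableau with a single column, the Young symmetrizer is the antisymmetrizer. -/
theorem asAlgebraHom_youngSymmetrizer_of_column {t : Fin n → ℕ × ℕ}
    (hrow : ∀ i j, (t i).1 = (t j).1 → i = j) (hcol : ∀ i j, (t i).2 = (t j).2) (m : M) :
    ρ.asAlgebraHom (youngSymmetrizer t) m =
      ∑ τ : Equiv.Perm (Fin n), permSign τ • ρ τ m := by
  rw [asAlgebraHom_youngSymmetrizer]
  have h1 : (Finset.univ.filter fun σ : Equiv.Perm (Fin n) => ∀ i, (t (σ i)).1 = (t i).1) =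
      {1} := by
    ext σ
    simp only [Finset.mem_filter, Finset.mem_univ, true_and, Finset.mem_singleton]
    constructor
    · intro h
      ext i
      rw [hrow _ _ (h i), Equiv.Perm.one_apply]
    · rintro rfl i
      rfl
  have h2 : (Finset.univ.filter fun σ : Equiv.Perm (Fin n) => ∀ i, (t (σ i)).2 = (t i).2) =
      Finset.univ := by
    ext σ
    simp only [Finset.mem_filter, Finset.mem_univ, true_and, iff_true]
    exact fun i => hcol _ _
  rw [h1, h2, Finset.sum_singleton, map_one, Module.End.one_apply]

theorem apply_signed_sum (π : Equiv.Perm (Fin n)) (m : M) :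
    ρ π (∑ τ : Equiv.Perm (Fin n), permSign τ • ρ τ m) =
      permSign π • ∑ τ : Equiv.Perm (Fin n), permSign τ • ρ τ m := by
  rw [map_sum, Finset.smul_sum, ← Equiv.sum_comp (Equiv.mulLeft π)
    fun σ => permSign π • permSign σ • ρ σ m]
  refine Finset.sum_congr rfl fun σ _ => ?_
  rw [Equiv.coe_mulLeft, map_smul, map_mul, Module.End.mul_apply, smul_smul, permSign_mul,
    ← mul_assoc, permSign_mul_self, one_mul]

/-- The antisymmetrizer produces alternating vectors and acts on them as the nonzero scalar `n!`. -/
theorem mem_isotypicBlock_of_column {t : Fin n → ℕ × ℕ}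
    (hrow : ∀ i j, (t i).1 = (t j).1 → i = j) (hcol : ∀ i j, (t i).2 = (t j).2) {v : M} :
    v ∈ isotypicBlock ρ t ↔ ∀ π, ρ π v = permSign π • v := by
  constructor
  · intro hv
    let N : Submodule ℂ M :=
      { carrier := {v | ∀ π, ρ π v = permSign π • v}
        add_mem' := fun ha hb π => by rw [map_add, ha π, hb π, smul_add]
        zero_mem' := fun π => by rw [map_zero, smul_zero]
        smul_mem' := fun c v hv π => by rw [map_smul, hv π, smul_comm] }
    refine isotypicBlock_le ρ (N := N) ?_ ?_ hv
    · intro π v hv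
      rw [hv π]
      exact N.smul_mem _ hv
    · intro m π
      rw [asAlgebraHom_youngSymmetrizer_of_column ρ hrow hcol]
      exact apply_signed_sum ρ π m
  · intro hv
    have h1 : ρ.asAlgebraHom (youngSymmetrizer t) v = (n.factorial : ℂ) • v := by
      rw [asAlgebraHom_youngSymmetrizer_of_column ρ hrow hcol,
        Finset.sum_congr rfl (g := fun _ => v), Finset.sum_const, Finset.card_univ,
        Fintype.card_perm, Fintype.card_fin, Nat.cast_smul_eq_nsmul]
      intro τ _
      rw [hv τ, smul_smul, permSign_mul_self, one_smul]
    have h2 := asAlgebraHom_mem_isotypicBlock ρ t 1 v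
    rw [h1, map_one, Module.End.one_apply] at h2
    refine (Submodule.smul_mem_iff _ ?_).mp h2
    exact_mod_cast n.factorial_ne_zero

end Isotypic

/-! ### The two tableaux -/

theorem permSign_viaEmbeddingHom {n j : ℕ} (hj : j ≤ n) (π : Equiv.Perm (Fin j)) :
    permSign (Equiv.Perm.viaEmbeddingHom (Fin.castLEEmb hj) π) = permSign π := by
  classical
  rw [permSign, permSign, Equiv.Perm.viaEmbeddingHom_apply, Equiv.Perm.viaEmbedding,
    Equiv.Perm.sign_extendDomain]

theorem permRepFirst_apply {n j : ℕ} (hj : j ≤ n) (π : Equiv.Perm (Fin j))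
    (v : TensorSpace n k) : permRepFirst k hj π v =
      permRep n k (Equiv.Perm.viaEmbeddingHom (Fin.castLEEmb hj) π) v := rfl

theorem permRepFirst_le_rfl (n k : ℕ) : permRepFirst k (le_refl n) = permRep n k := by
  have h : Equiv.Perm.viaEmbeddingHom (Fin.castLEEmb (le_refl n)) = MonoidHom.id _ := by
    ext π i
    have := Equiv.Perm.viaEmbedding_apply π (Fin.castLEEmb (le_refl n)) i
    rw [Equiv.Perm.viaEmbeddingHom_apply]
    simpa using congrArg Fin.val this
  rw [permRepFirst, h]
  rfl

theorem mem_tableauSpace {n : ℕ} {μ : YoungDiagram} {t : StdTableau n μ} {v : TensorSpace n k} :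
    v ∈ tableauSpace k t ↔ ∀ (j : ℕ) (hj : j ≤ n),
      v ∈ isotypicBlock (permRepFirst k hj) (t.pos ∘ Fin.castLE hj) := by
  simp [tableauSpace, Submodule.mem_iInf]

theorem mem_diagramBlock_of_mem_tableauSpace {n : ℕ} {μ : YoungDiagram} {t : StdTableau n μ}
    {v : TensorSpace n k} (hv : v ∈ tableauSpace k t) : v ∈ diagramBlock k t := by
  have h := mem_tableauSpace.mp hv n le_rfl
  rw [permRepFirst_le_rfl] at h
  exact h

theorem mem_diagramBlock_colTableau {v : TensorSpace k k} :
    v ∈ diagramBlock k (colTableau k) ↔ ∀ π, permRep k k π v = permSign π • v :=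
  mem_isotypicBlock_of_column (permRep k k) (fun _ _ h => Fin.ext h) (fun _ _ => rfl)

/-- The condition for `j = k` already leaves only the determinant line; the conditions for smaller
`j` hold on it because extending a permutation by fixed points preserves the sign. -/
theorem tableauSpace_colTableau : tableauSpace k (colTableau k) =
    Submodule.span ℂ {detVector k} := by
  apply le_antisymm
  · intro v hv
    rw [eq_smul_detVector (mem_diagramBlock_colTableau.mp
      (mem_diagramBlock_of_mem_tableauSpace hv))]
    exact Submodule.smul_mem _ _ (Submodule.mem_span_singleton_self _)
  · rw [Submodule.span_singleton_le_iff_mem, mem_tableauSpace]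
    intro j hj
    rw [mem_isotypicBlock_of_column (permRepFirst k hj)
      (fun _ _ h => Fin.ext h) (fun _ _ => rfl)]
    intro π
    rw [permRepFirst_apply, permRep_detVector, permSign_viaEmbeddingHom]

theorem weylModule_colTableau : weylModule k (colTableau k) =
    Submodule.span ℂ {detVector k} := by
  have hact := fun m => asAlgebraHom_youngSymmetrizer_of_column (permRep k k)
    (t := (colTableau k).pos) (fun _ _ h => Fin.ext h) (fun _ _ => rfl) m
  apply le_antisymm
  · rintro _ ⟨m, rfl⟩
    rw [hact m, eq_smul_detVector fun π => apply_signed_sum (permRep k k) π m]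
    exact Submodule.smul_mem _ _ (Submodule.mem_span_singleton_self _)
  · rw [Submodule.span_singleton_le_iff_mem]
    refine ⟨(k.factorial : ℂ)⁻¹ • detVector k, ?_⟩
    rw [hact, Finset.sum_congr rfl (g := fun _ => (k.factorial : ℂ)⁻¹ • detVector k),
      Finset.sum_const, Finset.card_univ, Fintype.card_perm, Fintype.card_fin,
      ← Nat.cast_smul_eq_nsmul ℂ, smul_smul, mul_inv_cancel₀, one_smul]
    · exact_mod_cast k.factorial_ne_zero
    · intro τ _
      rw [map_smul, permRep_detVector, smul_comm, smul_smul (permSign τ), permSign_mul_self,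
        one_smul]

theorem isInvariant_span_detVector : IsInvariant (Submodule.span ℂ {detVector k}) := by
  intro U v hv
  obtain ⟨c, rfl⟩ := Submodule.mem_span_singleton.mp hv
  rw [map_smul, unitaryAct_detVector]
  exact Submodule.smul_mem _ _ (Submodule.smul_mem _ _ (Submodule.mem_span_singleton_self _))

theorem finrank_span_detVector : Module.finrank ℂ (Submodule.span ℂ {detVector k}) = 1 :=
  finrank_span_singleton detVector_ne_zero

theorem isIrreducible_span_detVector : IsIrreducible (Submodule.span ℂ {detVector k}) := by
  refine ⟨isInvariant_span_detVector, ?_, ?_⟩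
  · rw [Ne, Submodule.span_singleton_eq_bot]
    exact detVector_ne_zero
  · intro W hW _
    exact (nonzero_span_atom _ detVector_ne_zero).le_iff.mp hW

/-- The intertwiner goes from `W` onto `W'`, whereas the conclusion asks for a map from `W'` to `W`.
Its inverse is equivariant because the defect lies in `W`, where `f` has no kernel. -/
theorem areEquivalent_of_map_eq {n : ℕ} {W W' : Submodule ℂ (TensorSpace n k)}
    (f : TensorSpace n k →ₗ[ℂ] TensorSpace n k)
    (hf : ∀ U v, f (unitaryAct n U v) = unitaryAct n U (f v)) (hinj : ∀ v ∈ W, f v = 0 → v = 0)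
    (hmap : W.map f = W') (hW : IsInvariant W) : AreEquivalent W' W := by
  have hW' : IsInvariant W' := by
    rintro U v hv
    rw [← hmap] at hv ⊢
    obtain ⟨w, hw, rfl⟩ := hv
    exact ⟨_, hW U w hw, hf U w⟩
  let g : W →ₗ[ℂ] W' := f.restrict fun v hv => hmap ▸ Submodule.mem_map_of_mem hv
  have hg : ∀ v : W, (g v : TensorSpace n k) = f v := fun _ => rfl
  have hbij : Function.Bijective g := by
    constructor
    · rw [← LinearMap.ker_eq_bot, LinearMap.ker_eq_bot']
      intro v hv
      exact Subtype.ext (hinj v v.2 (by rw [← hg, hv]; rfl))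
    · rintro ⟨w, hw⟩
      rw [← hmap] at hw
      obtain ⟨v, hv, rfl⟩ := hw
      exact ⟨⟨v, hv⟩, Subtype.ext rfl⟩
  refine ⟨hW', hW, (LinearEquiv.ofBijective g hbij).symm, fun U v w hvw => ?_⟩
  set e := LinearEquiv.ofBijective g hbij with he
  have hfe : ∀ u : W', f (e.symm u) = u := fun u => by
    rw [← hg]
    exact congrArg Subtype.val (e.apply_symm_apply u)
  rw [← sub_eq_zero]
  refine hinj _ (W.sub_mem (e.symm w).2 (hW U _ (e.symm v).2)) ?_
  rw [map_sub, hf, hfe, hfe, hvw, sub_self]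

theorem areEquivalent_colTableau :
    AreEquivalent (weylModule k (colTableau k)) (tableauSpace k (colTableau k)) := by
  rw [weylModule_colTableau, tableauSpace_colTableau]
  exact areEquivalent_of_map_eq LinearMap.id (fun _ _ => rfl) (fun _ _ h => h)
    (Submodule.map_id _) isInvariant_span_detVector

/-- The first slot. -/
def firstSlot (hk : 2 ≤ k) : Fin k := ⟨0, by omega⟩

theorem firstSlot_ne_bob (hk : 2 ≤ k) : firstSlot hk ≠ bob hk := by
  intro h
  have := congrArg Fin.val h
  simp only [firstSlot, bob] at this
  omega

theorem hookTableau_col (hk : 2 ≤ k) (i : Fin k) :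
    ((hookTableau hk).pos i).2 = if i = bob hk then 1 else 0 := by
  have hi := i.2
  have h : i = bob hk ↔ ¬ (i : ℕ) < k - 1 := by
    rw [Fin.ext_iff, bob]
    simp only
    omega
  simp only [hookTableau, h]
  split_ifs <;> simp_all

theorem hookTableau_row (hk : 2 ≤ k) (i : Fin k) :
    ((hookTableau hk).pos i).1 = if i = bob hk then 0 else (i : ℕ) := by
  have hi := i.2
  have h : i = bob hk ↔ ¬ (i : ℕ) < k - 1 := by
    rw [Fin.ext_iff, bob]
    simp only
    omega
  simp only [hookTableau, h]
  split_ifs <;> simp_all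

/-- Only the first and the last entries share a row, so the row group is generated by their
transposition. The column group is the stabilizer of the last slot, since the second column has a
single box. -/
theorem asAlgebraHom_youngSymmetrizer_hookTableau (hk : 2 ≤ k) (m : TensorSpace k k) :
    (permRep k k).asAlgebraHom (youngSymmetrizer (hookTableau hk).pos) m =
      slotAlt (bob hk) m +
        permRep k k (Equiv.swap (firstSlot hk) (bob hk)) (slotAlt (bob hk) m) := by
  have hne := firstSlot_ne_bob hk
  rw [asAlgebraHom_youngSymmetrizer]
  have h1 : (Finset.univ.filter fun σ : Equiv.Perm (Fin k) =>
      ∀ i, ((hookTableau hk).pos (σ i)).1 = ((hookTableau hk).pos i).1) =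
      {1, Equiv.swap (firstSlot hk) (bob hk)} := by
    ext σ
    simp only [Finset.mem_filter, Finset.mem_univ, true_and, Finset.mem_insert,
      Finset.mem_singleton, hookTableau_row]
    have hval : ∀ i : Fin k, (i : ℕ) = 0 ↔ i = firstSlot hk := fun i => by
      rw [Fin.ext_iff, firstSlot]
    constructor
    · intro h
      have hfix : ∀ i, i ≠ bob hk → i ≠ firstSlot hk → σ i = i := by
        intro i hib hio
        have := h i
        rw [if_neg hib] at this
        split_ifs at this with hs
        · exact absurd ((hval i).mp this.symm) hio
        · exact Fin.ext this
      have hfirst : σ (firstSlot hk) = firstSlot hk ∨ σ (firstSlot hk) = bob hk := by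
        have := h (firstSlot hk)
        rw [if_neg hne] at this
        split_ifs at this with hs
        · exact Or.inr hs
        · exact Or.inl (Fin.ext this)
      have hlast : σ (bob hk) = firstSlot hk ∨ σ (bob hk) = bob hk := by
        have := h (bob hk)
        rw [if_pos rfl] at this
        split_ifs at this with hs
        · exact Or.inr hs
        · exact Or.inl ((hval _).mp this)
      rcases hfirst with hf | hf
      · left
        have hl : σ (bob hk) = bob hk :=
          hlast.resolve_left fun h' => hne (σ.injective (hf.trans h'.symm))
        refine Equiv.ext fun i => ?_
        by_cases hib : i = bob hk
        · rw [hib, hl, Equiv.Perm.one_apply]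
        by_cases hio : i = firstSlot hk
        · rw [hio, hf, Equiv.Perm.one_apply]
        · rw [hfix i hib hio, Equiv.Perm.one_apply]
      · right
        have hl : σ (bob hk) = firstSlot hk :=
          hlast.resolve_right fun h' => hne (σ.injective (hf.trans h'.symm))
        refine Equiv.ext fun i => ?_
        by_cases hib : i = bob hk
        · rw [hib, hl, Equiv.swap_apply_right]
        by_cases hio : i = firstSlot hk
        · rw [hio, hf, Equiv.swap_apply_left]
        · rw [hfix i hib hio, Equiv.swap_apply_of_ne_of_ne hio hib]
    · rintro (rfl | rfl) i
      · rfl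
      · by_cases hib : i = bob hk
        · simp [hib, hne, (hval (firstSlot hk)).mpr rfl]
        by_cases hio : i = firstSlot hk
        · simp [hio, hne, (hval (firstSlot hk)).mpr rfl]
        · rw [Equiv.swap_apply_of_ne_of_ne hio hib]
  have h2 : (Finset.univ.filter fun σ : Equiv.Perm (Fin k) =>
      ∀ i, ((hookTableau hk).pos (σ i)).2 = ((hookTableau hk).pos i).2) =
      Finset.univ.filter fun σ : Equiv.Perm (Fin k) => σ (bob hk) = bob hk := by
    ext σ
    simp only [Finset.mem_filter, Finset.mem_univ, true_and, hookTableau_col]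
    constructor
    · intro h
      have := h (bob hk)
      by_contra hc
      simp [hc] at this
    · intro h i
      have : σ i = bob hk ↔ i = bob hk := by
        rw [← σ.injective.eq_iff (a := i), h]
      simp [this]
  rw [h1, h2, ← slotAlt_apply, Finset.sum_insert, Finset.sum_singleton, map_one,
    Module.End.one_apply]
  rw [Finset.mem_singleton]
  intro h
  apply hne
  rw [← Equiv.Perm.one_apply (firstSlot hk), h, Equiv.swap_apply_left]

/-- The permutations of the first `k - 1` slots are those fixing the last slot. -/
theorem exists_viaEmbeddingHom_eq (hk : 2 ≤ k) {π : Equiv.Perm (Fin k)}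
    (hπ : π (bob hk) = bob hk) :
    ∃ σ, Equiv.Perm.viaEmbeddingHom (Fin.castLEEmb (Nat.sub_le k 1)) σ = π := by
  have hlt : ∀ i : Fin (k - 1), (π (Fin.castLE (Nat.sub_le k 1) i) : ℕ) < k - 1 := by
    intro i
    have h1 : π (Fin.castLE (Nat.sub_le k 1) i) ≠ bob hk := by
      intro h
      have := congrArg Fin.val (π.injective (h.trans hπ.symm))
      simp only [Fin.val_castLE, bob] at this
      omega
    have h2 := (π (Fin.castLE (Nat.sub_le k 1) i)).2
    have h3 : (π (Fin.castLE (Nat.sub_le k 1) i) : ℕ) ≠ k - 1 := fun h => h1 (Fin.ext h)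
    omega
  let f : Fin (k - 1) → Fin (k - 1) := fun i => ⟨π (Fin.castLE (Nat.sub_le k 1) i), hlt i⟩
  have hf : Function.Injective f := by
    intro i j hij
    have h1 : (π (Fin.castLE (Nat.sub_le k 1) i) : ℕ) = π (Fin.castLE (Nat.sub_le k 1) j) :=
      congrArg (fun l : Fin (k - 1) => (l : ℕ)) hij
    exact Fin.castLE_injective _ (π.injective (Fin.ext h1))
  refine ⟨Equiv.ofBijective f (Finite.injective_iff_bijective.mp hf), Equiv.ext fun i => ?_⟩
  rw [Equiv.Perm.viaEmbeddingHom_apply]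
  by_cases hi : i = bob hk
  · rw [Equiv.Perm.viaEmbedding_apply_of_notMem, hi, hπ]
    rintro ⟨j, hj⟩
    have := congrArg Fin.val (hj.trans hi)
    simp only [Fin.castLEEmb_apply, Fin.val_castLE, bob] at this
    omega
  · have h2 := i.2
    have h3 : (i : ℕ) ≠ k - 1 := fun h => hi (Fin.ext h)
    have h4 : i = Fin.castLEEmb (Nat.sub_le k 1) ⟨i, by omega⟩ := Fin.ext rfl
    rw [h4, Equiv.Perm.viaEmbedding_apply]
    rfl

theorem viaEmbeddingHom_bob (hk : 2 ≤ k) {j : ℕ} (hj : j ≤ k) (hjk : j < k)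
    (π : Equiv.Perm (Fin j)) :
    Equiv.Perm.viaEmbeddingHom (Fin.castLEEmb hj) π (bob hk) = bob hk := by
  rw [Equiv.Perm.viaEmbeddingHom_apply, Equiv.Perm.viaEmbedding_apply_of_notMem]
  rintro ⟨i, hi⟩
  have := congrArg Fin.val hi
  simp only [Fin.castLEEmb_apply, Fin.val_castLE, bob] at this
  omega

/-- The antisymmetrizer changes sign under the row transposition, so it annihilates anything
symmetrized along that row. -/
theorem fullAlt_eq_zero_of_mem_diagramBlock (hk : 2 ≤ k) {v : TensorSpace k k}
    (hv : v ∈ diagramBlock k (hookTableau hk)) : fullAlt k v = 0 := by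
  refine isotypicBlock_le (permRep k k) (N := LinearMap.ker (fullAlt k)) ?_ ?_ hv
  · intro π v hv
    rw [LinearMap.mem_ker] at hv ⊢
    rw [fullAlt_permRep, hv, smul_zero]
  · intro m
    rw [LinearMap.mem_ker, asAlgebraHom_youngSymmetrizer_hookTableau, map_add, fullAlt_permRep,
      permSign_swap (firstSlot_ne_bob hk), neg_one_smul, add_neg_cancel]

theorem hookTableau_column (hk : 2 ≤ k) {j : ℕ} (hj : j ≤ k) (hjk : j < k) :
    (∀ i i', (((hookTableau hk).pos ∘ Fin.castLE hj) i).1 =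
      (((hookTableau hk).pos ∘ Fin.castLE hj) i').1 → i = i') ∧
    ∀ i i', (((hookTableau hk).pos ∘ Fin.castLE hj) i).2 =
      (((hookTableau hk).pos ∘ Fin.castLE hj) i').2 := by
  have hne : ∀ i : Fin j, Fin.castLE hj i ≠ bob hk := by
    intro i h
    have := congrArg Fin.val h
    simp only [Fin.val_castLE, bob] at this
    omega
  constructor
  · intro i i' h
    rw [Function.comp_apply, Function.comp_apply, hookTableau_row, hookTableau_row,
      if_neg (hne i), if_neg (hne i')] at h
    exact Fin.ext h
  · intro i i'
    rw [Function.comp_apply, Function.comp_apply, hookTableau_col, hookTableau_col,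
      if_neg (hne i), if_neg (hne i')]

/-- Removing the last entry leaves a column, so the conditions for `j < k` express alternation in
the first `k - 1` slots. The condition for `j = k` adds the vanishing of the full antisymmetrizer.
-/
theorem tableauSpace_hookTableau (hk : 2 ≤ k) :
    tableauSpace k (hookTableau hk) = tracelessSpace (bob hk) := by
  apply le_antisymm
  · intro v hv
    rw [mem_tracelessSpace_iff]
    refine ⟨?_, fullAlt_eq_zero_of_mem_diagramBlock hk (mem_diagramBlock_of_mem_tableauSpace hv)⟩
    intro π hπ
    obtain ⟨σ, rfl⟩ := exists_viaEmbeddingHom_eq hk hπ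
    have hc := hookTableau_column hk (Nat.sub_le k 1) (by omega)
    have h := (mem_isotypicBlock_of_column _ hc.1 hc.2).mp
      (mem_tableauSpace.mp hv (k - 1) (Nat.sub_le k 1)) σ
    rw [permSign_viaEmbeddingHom, ← permRepFirst_apply, h]
  · intro v hv
    rw [mem_tableauSpace]
    intro j hj
    rcases hj.lt_or_eq with hjk | rfl
    · have hc := hookTableau_column hk hj hjk
      rw [mem_isotypicBlock_of_column _ hc.1 hc.2]
      intro π
      rw [permRepFirst_apply, tracelessSpace_le_altSpace _ hv _ (viaEmbeddingHom_bob hk hj hjk π),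
        permSign_viaEmbeddingHom]
    · rw [permRepFirst_le_rfl]
      change v ∈ isotypicBlock (permRep j j) (hookTableau hk).pos
      obtain ⟨c, hc, h⟩ := exists_slotAlt_add_swap (firstSlot_ne_bob hk)
      -- Applying the column antisymmetrizer to the Young symmetrizer of `v` stays in the block and
      -- returns a nonzero multiple of `v`.
      have h1 := asAlgebraHom_mem_isotypicBlock (permRep j j) (hookTableau hk).pos
        (∑ π : Equiv.Perm (Fin j) with π (bob hk) = bob hk, MonoidAlgebra.single π (permSign π)) v
      have h2 : (permRep j j).asAlgebraHom (∑ π : Equiv.Perm (Fin j) with π (bob hk) = bob hk,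
          MonoidAlgebra.single π (permSign π)) = slotAlt (bob hk) := by
        rw [map_sum, slotAlt]
        simp only [Representation.asAlgebraHom_single]
      rw [h2, asAlgebraHom_youngSymmetrizer_hookTableau,
        slotAlt_of_mem (tracelessSpace_le_altSpace _ hv), map_smul, ← smul_add, map_smul,
        h v hv] at h1
      refine (Submodule.smul_mem_iff _ hc).mp ((Submodule.smul_mem_iff _ ?_).mp h1)
      exact_mod_cast (Nat.factorial_pos _).ne'

/-- The row symmetrizer `1 + (o b)` intertwines the two spaces. It is injective on the traceless
part and kills the determinant line, so it maps the traceless part onto the whole image of the Young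
symmetrizer. -/
theorem areEquivalent_hookTableau (hk : 2 ≤ k) :
    AreEquivalent (weylModule k (hookTableau hk)) (tableauSpace k (hookTableau hk)) := by
  rw [tableauSpace_hookTableau]
  refine areEquivalent_of_map_eq
    (LinearMap.id + permRep k k (Equiv.swap (firstSlot hk) (bob hk))) ?_ ?_ ?_
    (isInvariant_tracelessSpace _)
  · intro U v
    rw [LinearMap.add_apply, LinearMap.add_apply, LinearMap.id_apply, LinearMap.id_apply,
      ← unitaryAct_permRep, map_add]
  · intro v hv h0
    obtain ⟨c, hc, h⟩ := exists_slotAlt_add_swap (firstSlot_ne_bob hk)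
    have h1 := h v hv
    rw [LinearMap.add_apply, LinearMap.id_apply] at h0
    rw [h0, map_zero] at h1
    exact (smul_eq_zero.mp h1.symm).resolve_left hc
  · have hfac : ((k - 1).factorial : ℂ) ≠ 0 := by exact_mod_cast (Nat.factorial_pos _).ne'
    apply le_antisymm
    · rintro _ ⟨v, hv, rfl⟩
      refine ⟨((k - 1).factorial : ℂ)⁻¹ • v, ?_⟩
      rw [asAlgebraHom_youngSymmetrizer_hookTableau, map_smul,
        slotAlt_of_mem (tracelessSpace_le_altSpace _ hv), smul_smul, inv_mul_cancel₀ hfac,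
        one_smul]
      rfl
    · rintro _ ⟨m, rfl⟩
      rw [asAlgebraHom_youngSymmetrizer_hookTableau]
      obtain ⟨c, w, hw, h⟩ := exists_add_of_mem_altSpace (slotAlt_mem_altSpace (bob hk) m)
      refine ⟨w, hw, ?_⟩
      rw [h, map_add, map_smul, permRep_detVector, permSign_swap (firstSlot_ne_bob hk),
        LinearMap.add_apply, LinearMap.id_apply]
      module

/-! ### The blocks of all other diagrams -/

theorem slotAlt_eq_zero_of_invariant {b i j : Fin k} (hib : i ≠ b) (hjb : j ≠ b) (hij : i ≠ j)
    {v : TensorSpace k k} (hv : permRep k k (Equiv.swap i j) v = v) : slotAlt b v = 0 := by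
  have h := slotAlt_permRep (Equiv.swap_apply_of_ne_of_ne (Ne.symm hib) (Ne.symm hjb)) v
  rw [hv, permSign_swap hij, neg_one_smul] at h
  have h2 : (2 : ℂ) • slotAlt b v = 0 := by
    rw [two_smul]
    nth_rewrite 1 [h]
    exact neg_add_cancel _
  exact (smul_eq_zero.mp h2).resolve_left two_ne_zero

/-- A Young diagram in which some box belongs to every pair of boxes in the same row is a column
or a hook with a single box outside the first column. -/
theorem eq_colShape_or_eq_hookShape {μ : YoungDiagram} {t : StdTableau k μ} (hk : 2 ≤ k)
    {e : Fin k} (h : ∀ i j, i ≠ j → (t.pos i).1 = (t.pos j).1 → i = e ∨ j = e) :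
    μ = colShape k ∨ μ = hookShape k := by
  have hcard : μ.cells.card = k := by
    have : μ.cells = Finset.univ.image t.pos := by
      ext c
      have := Set.ext_iff.mp t.range_pos c
      simpa using this.symm
    rw [this, Finset.card_image_of_injective _ t.pos_injective, Finset.card_univ,
      Fintype.card_fin]
  have hbox : ∀ c ∈ μ, ∀ c' ∈ μ, c ≠ c' → c.1 = c'.1 → c = t.pos e ∨ c' = t.pos e := by
    intro c hc c' hc' hne hrow
    obtain ⟨i, rfl⟩ : c ∈ Set.range t.pos := by rw [t.range_pos]; exact hc
    obtain ⟨j, rfl⟩ : c' ∈ Set.range t.pos := by rw [t.range_pos]; exact hc'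
    rcases h i j (fun hij => hne (by rw [hij])) hrow with rfl | rfl
    · exact Or.inl rfl
    · exact Or.inr rfl
  by_cases h01 : (0, 1) ∈ μ
  · right
    have h00 : (0, 0) ∈ μ := μ.up_left_mem le_rfl (by omega) h01
    have h0 := hbox _ h00 _ h01 (by simp) rfl
    -- Three boxes in a row form three pairs with no box common to all of them.
    have h02 : (0, 2) ∉ μ := by
      intro h02
      have h1 := hbox _ h00 _ h02 (by simp) rfl
      have h2 := hbox _ h01 _ h02 (by simp) rfl
      rcases h0 with h0 | h0 <;> rw [← h0] at h1 h2 <;> simp at h1 h2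
    -- A pair of boxes in the second row would be disjoint from the pair in the first.
    have h11 : (1, 1) ∉ μ := by
      intro h11
      have h10 : (1, 0) ∈ μ := μ.up_left_mem le_rfl (by omega) h11
      have h1 := hbox _ h10 _ h11 (by simp) rfl
      rcases h0 with h0 | h0 <;> rw [← h0] at h1 <;> simp at h1
    have hform : ∀ c, c ∈ μ ↔ (c.1 < μ.colLen 0 ∧ c.2 = 0) ∨ c = (0, 1) := by
      rintro ⟨i, j⟩
      constructor
      · intro hc
        match j with
        | 0 => exact Or.inl ⟨YoungDiagram.mem_iff_lt_colLen.mp hc, rfl⟩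
        | 1 =>
          match i with
          | 0 => exact Or.inr rfl
          | i + 1 => exact absurd (μ.up_left_mem (by omega) le_rfl hc) h11
        | j + 2 => exact absurd (μ.up_left_mem (Nat.zero_le _) (by omega) hc) h02
      · rintro (⟨hi, rfl⟩ | hc)
        · exact YoungDiagram.mem_iff_lt_colLen.mpr hi
        · rw [hc]
          exact h01
    have hlen : μ.colLen 0 = k - 1 := by
      have hcells : μ.cells = insert (0, 1) ((Finset.range (μ.colLen 0)).image fun i => (i, 0)) := by
        ext c
        rw [YoungDiagram.mem_cells, hform]
        obtain ⟨i, j⟩ := c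
        simp only [Finset.mem_insert, Finset.mem_image, Finset.mem_range, Prod.mk.injEq]
        constructor
        · rintro (⟨h1, rfl⟩ | h1)
          · exact Or.inr ⟨i, h1, rfl, rfl⟩
          · exact Or.inl h1
        · rintro (h1 | ⟨a, h1, rfl, rfl⟩)
          · exact Or.inr h1
          · exact Or.inl ⟨h1, rfl⟩
      rw [hcells, Finset.card_insert_of_notMem (by simp), Finset.card_image_of_injective _
        (fun a b hab => (Prod.mk.inj hab).1), Finset.card_range] at hcard
      omega
    ext c
    rw [YoungDiagram.mem_cells, YoungDiagram.mem_cells, hform, mem_hookShape hk, hlen]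
  · left
    have hform : ∀ c, c ∈ μ ↔ c.1 < μ.colLen 0 ∧ c.2 = 0 := by
      rintro ⟨i, j⟩
      constructor
      · intro hc
        match j with
        | 0 => exact ⟨YoungDiagram.mem_iff_lt_colLen.mp hc, rfl⟩
        | j + 1 => exact absurd (μ.up_left_mem (Nat.zero_le _) (by omega) hc) h01
      · rintro ⟨hi, rfl⟩
        exact YoungDiagram.mem_iff_lt_colLen.mpr hi
    have hlen : μ.colLen 0 = k := by
      have hcells : μ.cells = (Finset.range (μ.colLen 0)).image fun i => (i, 0) := by
        ext c
        rw [YoungDiagram.mem_cells, hform]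
        obtain ⟨i, j⟩ := c
        simp only [Finset.mem_image, Finset.mem_range, Prod.mk.injEq]
        constructor
        · rintro ⟨h1, rfl⟩
          exact ⟨i, h1, rfl, rfl⟩
        · rintro ⟨a, h1, rfl, rfl⟩
          exact ⟨h1, rfl⟩
      rw [hcells, Finset.card_image_of_injective _ (fun a b hab => (Prod.mk.inj hab).1),
        Finset.card_range] at hcard
      exact hcard
    ext c
    rw [YoungDiagram.mem_cells, YoungDiagram.mem_cells, hform, mem_colShape, hlen]

theorem permRep_swap_youngSymmetrizer {t : Fin k → ℕ × ℕ} {i j : Fin k}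
    (hij : (t i).1 = (t j).1) (m : TensorSpace k k) :
    permRep k k (Equiv.swap i j) ((permRep k k).asAlgebraHom (youngSymmetrizer t) m) =
      (permRep k k).asAlgebraHom (youngSymmetrizer t) m := by
  have hs : ∀ l, (t (Equiv.swap i j l)).1 = (t l).1 := by
    intro l
    by_cases hi : l = i
    · rw [hi, Equiv.swap_apply_left, hij]
    by_cases hj : l = j
    · rw [hj, Equiv.swap_apply_right, hij]
    · rw [Equiv.swap_apply_of_ne_of_ne hi hj]
  rw [asAlgebraHom_youngSymmetrizer, map_sum]
  refine Finset.sum_bij' (fun σ _ => Equiv.swap i j * σ) (fun σ _ => Equiv.swap i j * σ)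
    ?_ ?_ ?_ ?_ ?_
  · intro σ hσ
    simp_all
  · intro σ hσ
    simp_all
  · simp [← mul_assoc]
  · simp [← mul_assoc]
  · intro σ _
    rw [permRep_mul_apply]

/-- A diagram other than the column and the hook has, for any chosen entry, two further entries in a
common row. The Young symmetrizer is symmetric in those two slots, and antisymmetrizing over a set
of slots containing both gives zero. -/
theorem slotAlt_eq_zero_of_mem_diagramBlock (hk : 2 ≤ k) {μ : YoungDiagram} (t : StdTableau k μ)
    (hcol : μ ≠ colShape k) (hhook : μ ≠ hookShape k) (b : Fin k) {v : TensorSpace k k}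
    (hv : v ∈ diagramBlock k t) : slotAlt b v = 0 := by
  -- The kernel of `slotAlt b` alone need not be stable under `S_k`; the intersection over all
  -- translates is.
  have hle : diagramBlock k t ≤
      ⨅ π : Equiv.Perm (Fin k), LinearMap.ker (slotAlt b ∘ₗ permRep k k π) := by
    refine isotypicBlock_le (permRep k k) ?_ ?_
    · intro π v hv
      rw [Submodule.mem_iInf] at hv ⊢
      intro σ
      exact hv (σ * π)
    · intro m
      rw [Submodule.mem_iInf]
      intro σ
      rw [LinearMap.mem_ker, LinearMap.comp_apply]
      have hex : ∃ i j, i ≠ j ∧ (t.pos i).1 = (t.pos j).1 ∧ i ≠ σ⁻¹ b ∧ j ≠ σ⁻¹ b := by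
        by_contra! hcon
        rcases eq_colShape_or_eq_hookShape hk (t := t) (e := σ⁻¹ b) (fun i j hij hrow =>
          or_iff_not_imp_left.mpr fun hi => hcon i j hij hrow hi) with h | h
        · exact hcol h
        · exact hhook h
      obtain ⟨i, j, hij, hrow, hi, hj⟩ := hex
      have hne : ∀ l, l ≠ σ⁻¹ b → σ l ≠ b := fun l hl h => hl (by rw [← h]; simp)
      refine slotAlt_eq_zero_of_invariant (hne i hi) (hne j hj) (fun h => hij (σ.injective h)) ?_
      rw [← permRep_mul_apply, Equiv.swap_apply_apply, inv_mul_cancel_right, permRep_mul_apply,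
        permRep_swap_youngSymmetrizer hrow]
  have h := (Submodule.mem_iInf _).mp (hle hv) 1
  rw [LinearMap.mem_ker, LinearMap.comp_apply, map_one, Module.End.one_apply] at h
  exact h

theorem inner_permRep (π : Equiv.Perm (Fin k)) (u v : TensorSpace k k) :
    inner ℂ u (permRep k k π v) = inner ℂ (permRep k k π⁻¹ u) v := by
  rw [PiLp.inner_apply, PiLp.inner_apply,
    ← Equiv.sum_comp (Equiv.arrowCongr π (Equiv.refl (Fin k)))]
  refine Finset.sum_congr rfl fun x _ => ?_
  rw [permRep_apply, permRep_apply]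
  have : (Equiv.arrowCongr π (Equiv.refl (Fin k)) x) ∘ π = x := by
    funext i
    simp
  rw [this]
  rfl

/-- The operator `slotAlt b` is self-adjoint and acts as `(k - 1)!` on `altSpace b`, so it can be
moved from one argument to the other. -/
theorem inner_eq_zero_of_slotAlt_eq_zero {b : Fin k} {u v : TensorSpace k k}
    (hu : u ∈ altSpace b) (hv : slotAlt b v = 0) : inner ℂ u v = 0 := by
  have h : inner ℂ u (slotAlt b v) = ((k - 1).factorial : ℂ) * inner ℂ u v := by
    rw [slotAlt_apply, inner_sum, Finset.sum_congr rfl (g := fun _ => inner ℂ u v),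
      Finset.sum_const, card_filter_perm_apply_eq, nsmul_eq_mul]
    intro π hπ
    have hπ' : π⁻¹ b = b := by
      rw [Equiv.Perm.inv_eq_iff_eq, (Finset.mem_filter.mp hπ).2]
    rw [inner_smul_right, inner_permRep, hu _ hπ', inner_smul_left, permSign_inv]
    have hs : (starRingEnd ℂ) (permSign π) = permSign π := star_permSign π
    rw [hs, ← mul_assoc, permSign_mul_self, one_mul]
  rw [hv, inner_zero_right] at h
  refine (mul_eq_zero.mp h.symm).resolve_left ?_
  exact Nat.cast_ne_zero.mpr (Nat.factorial_ne_zero _)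

/-! ### Schur's lemma for the tensors alternating in all slots but one -/

theorem unitaryAct_fullAlt (U : UG k) (v : TensorSpace k k) :
    fullAlt k (unitaryAct k U v) = unitaryAct k U (fullAlt k v) := by
  simp only [fullAlt_apply, map_sum, map_smul, unitaryAct_permRep]

section Schur

variable {N : TensorSpace k k →ₗ[ℂ] TensorSpace k k} {b : Fin k}

/-- The composite of `N` with the full antisymmetrizer maps the traceless part into a line. Its
kernel there is invariant, hence zero or everything, and zero is excluded by dimension. -/
theorem map_mem_tracelessSpace (hk : 2 ≤ k)
    (hcomm : ∀ (U : UG k) v, N (unitaryAct k U v) = unitaryAct k U (N v))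
    (hrange : ∀ v, N v ∈ altSpace b) {w : TensorSpace k k} (hw : w ∈ tracelessSpace b) :
    N w ∈ tracelessSpace b := by
  have hinv : IsInvariant (tracelessSpace b ⊓ LinearMap.ker (fullAlt k ∘ₗ N)) := by
    rintro U v ⟨h1, h2⟩
    refine ⟨isInvariant_tracelessSpace b U v h1, ?_⟩
    rw [SetLike.mem_coe, LinearMap.mem_ker, LinearMap.comp_apply] at h2 ⊢
    rw [hcomm, unitaryAct_fullAlt, h2, map_zero]
  rcases (isIrreducible_tracelessSpace hk b).2.2 _ inf_le_left hinv with h | h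
  · exfalso
    have hmem : ∀ v ∈ tracelessSpace b, (fullAlt k ∘ₗ N) v ∈ Submodule.span ℂ {detVector k} := by
      intro v _
      rw [LinearMap.comp_apply, eq_smul_detVector fun π => permRep_fullAlt π (N v)]
      exact Submodule.smul_mem _ _ (Submodule.mem_span_singleton_self _)
    have hinj : Function.Injective ((fullAlt k ∘ₗ N).restrict hmem) := by
      rw [← LinearMap.ker_eq_bot, LinearMap.ker_eq_bot']
      intro v hv
      have h1 : (v : TensorSpace k k) ∈ tracelessSpace b ⊓ LinearMap.ker (fullAlt k ∘ₗ N) :=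
        ⟨v.2, LinearMap.mem_ker.mpr (congrArg Subtype.val hv)⟩
      rw [h, Submodule.mem_bot] at h1
      exact Subtype.ext h1
    have h1 := LinearMap.finrank_le_finrank_of_injective hinj
    rw [finrank_span_detVector] at h1
    have := one_lt_finrank_tracelessSpace hk b
    omega
  · rw [← h] at hw
    exact mem_tracelessSpace_iff.mpr ⟨hrange w, hw.2⟩

/-- The traceless component of the image transforms by `det U`, so it spans an invariant subspace of
dimension at most one in an irreducible space of larger dimension; it must vanish. -/
theorem exists_map_detVector (hk : 2 ≤ k)
    (hcomm : ∀ (U : UG k) v, N (unitaryAct k U v) = unitaryAct k U (N v))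
    (hrange : ∀ v, N v ∈ altSpace b) : ∃ α : ℂ, N (detVector k) = α • detVector k := by
  obtain ⟨c, w, hw, h⟩ := exists_add_of_mem_altSpace (hrange (detVector k))
  refine ⟨c, ?_⟩
  have hle : Submodule.span ℂ {w} ≤ tracelessSpace b := by
    rwa [Submodule.span_singleton_le_iff_mem]
  have hinv : IsInvariant (Submodule.span ℂ {w}) := by
    intro U v hv
    obtain ⟨a, rfl⟩ := Submodule.mem_span_singleton.mp hv
    have hw' : w = N (detVector k) - c • detVector k := by rw [h, add_sub_cancel_left]
    have hU : unitaryAct k U w = (U : Matrix (Fin k) (Fin k) ℂ).det • w := by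
      rw [hw', map_sub, ← hcomm, map_smul, unitaryAct_detVector, map_smul, smul_sub,
        smul_comm c]
    rw [map_smul, hU]
    exact Submodule.smul_mem _ _ (Submodule.smul_mem _ _ (Submodule.mem_span_singleton_self _))
  rcases (isIrreducible_tracelessSpace hk b).2.2 _ hle hinv with h0 | h0
  · rw [h, Submodule.span_singleton_eq_bot.mp h0, add_zero]
  · have h1 := one_lt_finrank_tracelessSpace hk b
    rw [← h0] at h1
    have h2 := finrank_span_le_card (R := ℂ) ({w} : Set (TensorSpace k k))
    simp at h2
    omega

/-- Schur's lemma in the usual way: an eigenvalue exists over `ℂ`, and its eigenspace is invariant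
and nonzero. -/
theorem exists_map_tracelessSpace (hk : 2 ≤ k)
    (hcomm : ∀ (U : UG k) v, N (unitaryAct k U v) = unitaryAct k U (N v))
    (hrange : ∀ v, N v ∈ altSpace b) : ∃ β : ℂ, ∀ w ∈ tracelessSpace b, N w = β • w := by
  have hmaps : ∀ w ∈ tracelessSpace b, N w ∈ tracelessSpace b :=
    fun w hw => map_mem_tracelessSpace hk hcomm hrange hw
  have hnt : Nontrivial (tracelessSpace b) :=
    Module.nontrivial_of_finrank_pos (lt_trans one_pos (one_lt_finrank_tracelessSpace hk b))
  obtain ⟨β, hβ⟩ := Module.End.exists_eigenvalue (N.restrict hmaps)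
  obtain ⟨w, hw⟩ := hβ.exists_hasEigenvector
  refine ⟨β, ?_⟩
  have hinv : IsInvariant (tracelessSpace b ⊓ LinearMap.ker (N - β • LinearMap.id)) := by
    rintro U v ⟨h1, h2⟩
    refine ⟨isInvariant_tracelessSpace b U v h1, ?_⟩
    rw [SetLike.mem_coe, LinearMap.mem_ker, LinearMap.sub_apply, LinearMap.smul_apply,
      LinearMap.id_apply] at h2 ⊢
    rw [hcomm, ← map_smul, ← map_sub, h2, map_zero]
  have hwmem : (w : TensorSpace k k) ∈
      tracelessSpace b ⊓ LinearMap.ker (N - β • LinearMap.id) := by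
    refine ⟨w.2, ?_⟩
    have h1 : N w = β • (w : TensorSpace k k) := congrArg Subtype.val hw.apply_eq_smul
    rw [SetLike.mem_coe, LinearMap.mem_ker, LinearMap.sub_apply, LinearMap.smul_apply,
      LinearMap.id_apply, h1, sub_self]
  rcases (isIrreducible_tracelessSpace hk b).2.2 _ inf_le_left hinv with h | h
  · rw [h, Submodule.mem_bot] at hwmem
    exact absurd (Subtype.ext hwmem) hw.2
  · intro v hv
    rw [← h] at hv
    have h1 := hv.2
    rw [SetLike.mem_coe, LinearMap.mem_ker, LinearMap.sub_apply, LinearMap.smul_apply,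
      LinearMap.id_apply, sub_eq_zero] at h1
    exact h1

/-- An operator that commutes with `U(k)` and is supported on the tensors alternating in all slots
but `b` is a combination of the two projectors. -/
theorem exists_eq_smul_starProjection (hk : 2 ≤ k)
    (hcomm : ∀ (U : UG k) v, N (unitaryAct k U v) = unitaryAct k U (N v))
    (hrange : ∀ v, N v ∈ altSpace b)
    (hker : ∀ v, (∀ u ∈ altSpace b, inner ℂ u v = 0) → N v = 0) :
    ∃ α β : ℂ, ∀ v, N v = α • (Submodule.span ℂ {detVector k}).starProjection v +
      β • (tracelessSpace b).starProjection v := by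
  obtain ⟨α, hα⟩ := exists_map_detVector hk hcomm hrange
  obtain ⟨β, hβ⟩ := exists_map_tracelessSpace hk hcomm hrange
  refine ⟨α, β, fun v => ?_⟩
  set p := (Submodule.span ℂ {detVector k}).starProjection v with hp
  set q := (tracelessSpace b).starProjection v with hq
  have hpmem : p ∈ Submodule.span ℂ {detVector k} := Submodule.starProjection_apply_mem _ v
  have hqmem : q ∈ tracelessSpace b := Submodule.starProjection_apply_mem _ v
  have hort := Submodule.isOrtho_iff_inner_eq.mp (isOrtho_span_detVector_tracelessSpace b)
  have h1 : N p = α • p := by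
    obtain ⟨c, hc⟩ := Submodule.mem_span_singleton.mp hpmem
    rw [← hc, map_smul, hα, smul_comm]
  -- The remainder is orthogonal to both summands of `altSpace b`, hence to all of it.
  have h0 : N (v - p - q) = 0 := by
    apply hker
    intro u hu
    obtain ⟨c, w, hw, rfl⟩ := exists_add_of_mem_altSpace hu
    have hd : c • detVector k ∈ Submodule.span ℂ {detVector k} :=
      Submodule.smul_mem _ _ (Submodule.mem_span_singleton_self _)
    have e1 : inner ℂ (c • detVector k) (v - p) = 0 :=
      Submodule.inner_right_of_mem_orthogonal hd (Submodule.sub_starProjection_mem_orthogonal v)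
    have e2 : inner ℂ w (v - q) = 0 :=
      Submodule.inner_right_of_mem_orthogonal hw (Submodule.sub_starProjection_mem_orthogonal v)
    have e3 : inner ℂ (c • detVector k) q = 0 := hort _ hd _ hqmem
    have e4 : inner ℂ w p = 0 := by
      rw [← inner_conj_symm, hort _ hpmem _ hw, map_zero]
    rw [inner_add_left, inner_sub_right, e1, e3, sub_right_comm, inner_sub_right, e2, e4]
    simp
  have h2 : v = p + q + (v - p - q) := by abel
  rw [h2, map_add, map_add, h0, h1, hβ q hqmem, add_zero]

end Schur

/-! ### Projector matrices -/

theorem starProjection_eq_sum {n : ℕ} (W : Submodule ℂ (TensorSpace n k)) (v : TensorSpace n k)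
    (x : Fin n → Fin k) : W.starProjection v x = ∑ y, projMatrix W x y * v y := by
  have hv : v = ∑ y, v y • EuclideanSpace.single y (1 : ℂ) := by
    ext z
    simp [Pi.single_apply]
  conv_lhs => rw [hv]
  simp only [map_sum, map_smul, projMatrix, Matrix.of_apply, WithLp.ofLp_sum, Finset.sum_apply,
    PiLp.smul_apply, smul_eq_mul]
  exact Finset.sum_congr rfl fun y _ => mul_comm _ _

theorem toEuclideanLin_projMatrix {n : ℕ} (W : Submodule ℂ (TensorSpace n k)) :
    Matrix.toEuclideanLin (projMatrix W) = (W.starProjection : TensorSpace n k →ₗ[ℂ] _) := by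
  ext1 v
  ext x
  exact (starProjection_eq_sum W v x).symm

theorem trace_projMatrix {n : ℕ} (W : Submodule ℂ (TensorSpace n k)) :
    (projMatrix W).trace = Module.finrank ℂ W := by
  have hproj : LinearMap.IsProj W (W.starProjection : TensorSpace n k →ₗ[ℂ] TensorSpace n k) :=
    ⟨fun v => Submodule.starProjection_apply_mem W v,
      fun v hv => Submodule.starProjection_eq_self_iff.mpr hv⟩
  rw [← hproj.trace, ← toEuclideanLin_projMatrix, Matrix.toEuclideanLin_eq_toLin_orthonormal,
    Matrix.trace_toLin_eq]

theorem projMatrix_mul_eq_zero {n : ℕ} {W W' : Submodule ℂ (TensorSpace n k)} (h : W ⟂ W') :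
    projMatrix W * projMatrix W' = 0 := by
  ext x y
  rw [Matrix.mul_apply]
  change ∑ z, projMatrix W x z * W'.starProjection (EuclideanSpace.single y (1 : ℂ)) z = 0
  rw [← starProjection_eq_sum, (Submodule.starProjection_apply_eq_zero_iff W).mpr]
  · rfl
  · exact h.symm (Submodule.starProjection_apply_mem _ _)

/-! ### Dualization -/

theorem sum_exchangeAt (b : Fin k) (f : (Fin k → Fin k) → Fin k → ℂ) :
    ∑ x, ∑ i, f x i = ∑ y, ∑ m, f (Function.update y b m) (y b) := by
  rw [← Fintype.sum_prod_type', ← Equiv.sum_comp (exchangeAt b), Fintype.sum_prod_type]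
  rfl

section Dualize

variable {d : ℕ} (hk : 2 ≤ k)
  (ρ : Matrix ((Fin k × Fin k) × (Fin d × Fin d)) ((Fin k × Fin k) × (Fin d × Fin d)) ℂ)

/-- The matrix of `|i₀ i₁⟩ ↦ ∑_a ε_{a i₀} |a i₁⟩`, tensored with the identity. -/
def dualizer (d : ℕ) {k : ℕ} (hk : 2 ≤ k) :
    Matrix ((Fin k → Fin k) × (Fin d × Fin d)) ((Fin k × Fin k) × (Fin d × Fin d)) ℂ :=
  Matrix.of fun p r => leviCivita (Function.update p.1 (bob hk) r.1.1) *
    if p.1 (bob hk) = r.1.2 ∧ p.2 = r.2 then 1 else 0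

/-- Writing the dualization as a conjugation makes positivity immediate. -/
theorem dualize_eq : dualize hk ρ = (((k - 1).factorial : ℕ) : ℂ)⁻¹ •
    (dualizer d hk * ρ * (dualizer d hk).conjTranspose) := by
  ext p q
  have hrow : ∀ (g : (Fin k × Fin k) × (Fin d × Fin d) → ℂ) (p : (Fin k → Fin k) × (Fin d × Fin d)),
      ∑ r, dualizer d hk p r * g r = ∑ i, leviCivita (Function.update p.1 (bob hk) i) *
        g ((i, p.1 (bob hk)), p.2) := by
    intro g p
    rw [Fintype.sum_prod_type, Fintype.sum_prod_type]
    refine Finset.sum_congr rfl fun i _ => ?_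
    rw [Finset.sum_eq_single (p.1 (bob hk)), Finset.sum_eq_single p.2]
    · simp [dualizer]
    · intro a _ ha
      simp [dualizer, Ne.symm ha]
    · simp
    · intro a _ ha
      simp [dualizer, Ne.symm ha]
    · simp
  have hstar : ∀ p r, star (dualizer d hk p r) = dualizer d hk p r := by
    intro p r
    simp only [dualizer, Matrix.of_apply, star_mul', star_leviCivita]
    split_ifs <;> simp
  rw [Matrix.smul_apply, Matrix.mul_apply, smul_eq_mul, dualize, Matrix.of_apply]
  congr 1
  simp only [Matrix.conjTranspose_apply, hstar, mul_comm _ (dualizer d hk q _)]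
  rw [hrow, Finset.sum_comm]
  refine Finset.sum_congr rfl fun j _ => ?_
  rw [Matrix.mul_apply, hrow, Finset.mul_sum]
  refine Finset.sum_congr rfl fun i _ => ?_
  ring

variable {ρ} in
theorem posSemidef_dualize (hρ : ρ.PosSemidef) : (dualize hk ρ).PosSemidef := by
  rw [dualize_eq]
  refine (hρ.mul_mul_conjTranspose_same _).smul ?_
  rw [inv_nonneg]
  exact_mod_cast Nat.zero_le _

theorem trace_dualize : (dualize hk ρ).trace = ρ.trace := by
  have hfac : ((k - 1).factorial : ℂ) ≠ 0 := by exact_mod_cast (Nat.factorial_pos _).ne'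
  have key : ∀ a : Fin d × Fin d, ∑ x : Fin k → Fin k, ∑ i, ∑ j,
      leviCivita (Function.update x (bob hk) i) * leviCivita (Function.update x (bob hk) j) *
        ρ ((i, x (bob hk)), a) ((j, x (bob hk)), a) =
      ((k - 1).factorial : ℂ) * ∑ i, ∑ m, ρ ((i, m), a) ((i, m), a) := by
    intro a
    -- After the exchange the first Levi-Civita factor no longer depends on the updated slot, so the
    -- sum runs over permutations; the second factor then forces `j = i`, and `(k - 1)!`
    -- permutations share each value at Bob's slot.
    rw [sum_exchangeAt (bob hk) (fun x i => ∑ j,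
      leviCivita (Function.update x (bob hk) i) * leviCivita (Function.update x (bob hk) j) *
        ρ ((i, x (bob hk)), a) ((j, x (bob hk)), a)),
      ← sum_perm_apply (bob hk) fun i => ∑ m, ρ ((i, m), a) ((i, m), a)]
    simp only [Function.update_idem, Function.update_eq_self, Function.update_self, mul_assoc,
      ← Finset.mul_sum]
    rw [sum_leviCivita_mul]
    refine Finset.sum_congr rfl fun σ _ => ?_
    simp only [leviCivita_update_perm, ite_mul, zero_mul, Finset.sum_ite_eq', Finset.mem_univ,
      if_true, ← Finset.mul_sum, ← mul_assoc, permSign_mul_self, one_mul]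
  simp only [Matrix.trace, Matrix.diag, dualize, Matrix.of_apply, ← Finset.mul_sum]
  rw [Fintype.sum_prod_type_right, Finset.sum_congr rfl fun a _ => key a, ← Finset.mul_sum,
    inv_mul_cancel_left₀ hfac]
  symm
  rw [Fintype.sum_prod_type_right]
  exact Finset.sum_congr rfl fun a _ => Fintype.sum_prod_type _

theorem dualize_column_mem_altSpace (a : Fin d × Fin d)
    (q : (Fin k → Fin k) × (Fin d × Fin d)) :
    (WithLp.toLp 2 fun x => dualize hk ρ (x, a) q : TensorSpace k k) ∈ altSpace (bob hk) := by
  intro π hπ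
  ext x
  rw [permRep_apply, PiLp.smul_apply, smul_eq_mul]
  simp only [dualize, Matrix.of_apply, update_comp_perm hπ, leviCivita_comp, Function.comp_apply,
    hπ, Finset.mul_sum]
  refine Finset.sum_congr rfl fun i _ => Finset.sum_congr rfl fun j _ => ?_
  ring

end Dualize

/-! ### The twirl -/

instance instIsMulLeftInvariantHaarU (k : ℕ) : (haarU k).IsMulLeftInvariant := by
  unfold haarU
  infer_instance

instance instIsProbabilityMeasureHaarU (k : ℕ) : IsProbabilityMeasure (haarU k) :=
  ⟨Measure.haarMeasure_self⟩

section Twirl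

variable {n d : ℕ}
  {σ : Matrix ((Fin n → Fin k) × (Fin d × Fin d)) ((Fin n → Fin k) × (Fin d × Fin d)) ℂ}

theorem auxUnitary_mul (U V : UG k) :
    auxUnitary n d (U * V) = auxUnitary n d U * auxUnitary n d V := by
  rw [auxUnitary, auxUnitary, auxUnitary, ← Matrix.mul_kronecker_mul, one_mul,
    Submonoid.coe_mul, tensorPow_mul]

theorem conjTranspose_auxUnitary (U : UG k) :
    (auxUnitary n d U).conjTranspose = auxUnitary n d U⁻¹ := by
  rw [auxUnitary, auxUnitary, Matrix.conjTranspose_kronecker, Matrix.conjTranspose_one,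
    tensorPow_conjTranspose]
  rfl

theorem auxUnitary_one : auxUnitary n d (1 : UG k) = 1 := by
  rw [auxUnitary, Submonoid.coe_one, tensorPow_one, Matrix.one_kronecker_one]

theorem continuous_auxUnitary : Continuous fun U : UG k => auxUnitary n d U := by
  refine continuous_matrix fun p q => ?_
  simp only [auxUnitary, Matrix.kroneckerMap_apply, tensorPow, Matrix.of_apply]
  refine Continuous.mul (continuous_finsetProd _ fun s _ => ?_) continuous_const
  exact (continuous_subtype_val).matrix_elem _ _

theorem integrable_conj_entry
    (σ : Matrix ((Fin n → Fin k) × (Fin d × Fin d)) ((Fin n → Fin k) × (Fin d × Fin d)) ℂ)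
    (p q : (Fin n → Fin k) × (Fin d × Fin d)) :
    Integrable (fun U : UG k => (auxUnitary n d U * σ * (auxUnitary n d U).conjTranspose) p q)
      (haarU k) := by
  have hc : Continuous fun U : UG k =>
      (auxUnitary n d U * σ * (auxUnitary n d U).conjTranspose) p q :=
    ((continuous_auxUnitary.matrix_mul continuous_const).matrix_mul
      continuous_auxUnitary.matrix_conjTranspose).matrix_elem p q
  exact hc.integrable_of_hasCompactSupport (HasCompactSupport.of_compactSpace _)

/-- Invariance and positivity of the twirl are both statements about finite linear combinations of
entries, and these pass through the integral. -/
theorem sum_mul_twirl (c : (Fin n → Fin k) × (Fin d × Fin d) →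
    (Fin n → Fin k) × (Fin d × Fin d) → ℂ) :
    ∑ p, ∑ q, c p q * twirl σ p q = ∫ U : UG k, ∑ p, ∑ q, c p q *
      (auxUnitary n d U * σ * (auxUnitary n d U).conjTranspose) p q ∂(haarU k) := by
  have hi : ∀ p q, Integrable (fun U : UG k => c p q *
      (auxUnitary n d U * σ * (auxUnitary n d U).conjTranspose) p q) (haarU k) :=
    fun p q => (integrable_conj_entry σ p q).const_mul _
  rw [integral_finsetSum _ fun p _ => integrable_finsetSum _ fun q _ => hi p q]
  refine Finset.sum_congr rfl fun p _ => ?_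
  rw [integral_finsetSum _ fun q _ => hi p q]
  refine Finset.sum_congr rfl fun q _ => ?_
  rw [integral_const_mul]
  rfl

theorem mul_mul_apply_eq_sum {ι : Type*} [Fintype ι] (A B C : Matrix ι ι ℂ) (p q : ι) :
    (A * B * C) p q = ∑ r, ∑ s, (A p r * C s q) * B r s := by
  simp only [Matrix.mul_apply, Finset.sum_mul]
  rw [Finset.sum_comm]
  refine Finset.sum_congr rfl fun r _ => Finset.sum_congr rfl fun s _ => ?_
  ring

/-- Conjugation by `V` replaces `U` by `V * U` under the integral, which left invariance of the Haar
measure absorbs. -/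
theorem auxUnitary_mul_twirl_mul (V : UG k) :
    auxUnitary n d V * twirl σ * (auxUnitary n d V).conjTranspose = twirl σ := by
  ext p q
  rw [mul_mul_apply_eq_sum, sum_mul_twirl]
  simp only [← mul_mul_apply_eq_sum]
  rw [twirl, Matrix.of_apply, ← integral_mul_left_eq_self (fun U : UG k =>
    (auxUnitary n d U * σ * (auxUnitary n d U).conjTranspose) p q) V]
  refine integral_congr_ae (Filter.Eventually.of_forall fun U => ?_)
  simp only [auxUnitary_mul, Matrix.conjTranspose_mul, mul_assoc]

theorem auxUnitary_mul_twirl (V : UG k) :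
    auxUnitary n d V * twirl σ = twirl σ * auxUnitary n d V := by
  conv_rhs => rw [← auxUnitary_mul_twirl_mul V]
  rw [mul_assoc _ _ (auxUnitary n d V), conjTranspose_auxUnitary, ← auxUnitary_mul,
    inv_mul_cancel, auxUnitary_one, mul_one]

theorem posSemidef_twirl (hσ : σ.PosSemidef) : (twirl σ).PosSemidef := by
  have hpos : ∀ U : UG k,
      (auxUnitary n d U * σ * (auxUnitary n d U).conjTranspose).PosSemidef :=
    fun U => hσ.mul_mul_conjTranspose_same _
  refine Matrix.PosSemidef.of_dotProduct_mulVec_nonneg ?_ ?_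
  · ext p q
    rw [Matrix.conjTranspose_apply, twirl, Matrix.of_apply, Matrix.of_apply]
    change (starRingEnd ℂ) _ = _
    rw [← integral_conj]
    refine integral_congr_ae (Filter.Eventually.of_forall fun U => ?_)
    exact (hpos U).1.apply p q
  · intro v
    have hquad : ∀ M : Matrix ((Fin n → Fin k) × (Fin d × Fin d))
        ((Fin n → Fin k) × (Fin d × Fin d)) ℂ,
        star v ⬝ᵥ M.mulVec v = ∑ p, ∑ q, (star (v p) * v q) * M p q := by
      intro M
      simp only [dotProduct, Matrix.mulVec, Finset.mul_sum, Pi.star_apply]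
      refine Finset.sum_congr rfl fun p _ => Finset.sum_congr rfl fun q _ => ?_
      ring
    rw [hquad, sum_mul_twirl]
    refine integral_nonneg fun U => ?_
    rw [Pi.zero_apply, ← hquad]
    exact (hpos U).dotProduct_mulVec_nonneg v

theorem trace_twirl : (twirl σ).trace = σ.trace := by
  have h : ∀ U : UG k, ∑ p, (auxUnitary n d U * σ * (auxUnitary n d U).conjTranspose) p p =
      σ.trace := by
    intro U
    change (auxUnitary n d U * σ * (auxUnitary n d U).conjTranspose).trace = _
    rw [Matrix.trace_mul_comm, ← mul_assoc, conjTranspose_auxUnitary, ← auxUnitary_mul,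
      inv_mul_cancel, auxUnitary_one, one_mul]
  have h2 : (twirl σ).trace = ∫ U : UG k, ∑ p,
      (auxUnitary n d U * σ * (auxUnitary n d U).conjTranspose) p p ∂(haarU k) := by
    rw [integral_finsetSum _ fun p _ => integrable_conj_entry σ p p]
    rfl
  rw [h2]
  simp only [h, integral_const, probReal_univ, one_smul]

end Twirl

/-! ### Blocks of the twirl and their matrix coefficients -/

section Blocks

variable {d : ℕ}
  {σ : Matrix ((Fin k → Fin k) × (Fin d × Fin d)) ((Fin k → Fin k) × (Fin d × Fin d)) ℂ}

/-- `U^{⊗k}` commutes with permutations of the slots, so each conjugated matrix keeps its columns in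
`altSpace b`. This is a linear condition on entries and survives integration. -/
theorem twirl_column_mem_altSpace {b : Fin k}
    (hσ : ∀ a q, (WithLp.toLp 2 fun x => σ (x, a) q : TensorSpace k k) ∈ altSpace b)
    (a : Fin d × Fin d) (q : (Fin k → Fin k) × (Fin d × Fin d)) :
    (WithLp.toLp 2 fun x => twirl σ (x, a) q : TensorSpace k k) ∈ altSpace b := by
  have hU : ∀ U : UG k, (WithLp.toLp 2 fun x => (auxUnitary k d U * σ *
      (auxUnitary k d U).conjTranspose) (x, a) q : TensorSpace k k) ∈ altSpace b := by
    intro U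
    have h1 : (WithLp.toLp 2 fun x => (σ * (auxUnitary k d U).conjTranspose) (x, a) q :
        TensorSpace k k) ∈ altSpace b := by
      have : (WithLp.toLp 2 fun x => (σ * (auxUnitary k d U).conjTranspose) (x, a) q :
          TensorSpace k k) = ∑ r, (auxUnitary k d U).conjTranspose r q •
          (WithLp.toLp 2 fun x => σ (x, a) r : TensorSpace k k) := by
        ext x
        simp only [Matrix.mul_apply, WithLp.ofLp_sum, Finset.sum_apply, PiLp.smul_apply,
          smul_eq_mul]
        exact Finset.sum_congr rfl fun r _ => mul_comm _ _
      rw [this]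
      exact Submodule.sum_mem _ fun r _ => Submodule.smul_mem _ _ (hσ a r)
    convert isInvariant_altSpace b U _ h1 using 1
    ext x
    rw [unitaryAct_apply]
    change (auxUnitary k d U * σ * (auxUnitary k d U).conjTranspose) (x, a) q = _
    rw [mul_assoc, Matrix.mul_apply, Fintype.sum_prod_type]
    refine Finset.sum_congr rfl fun y _ => ?_
    rw [Finset.sum_eq_single a]
    · simp [auxUnitary, Matrix.kroneckerMap_apply]
    · intro c _ hc
      simp [auxUnitary, Matrix.kroneckerMap_apply, Matrix.one_apply_ne (Ne.symm hc)]
    · simp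
  intro π hπ
  ext x
  rw [permRep_apply, PiLp.smul_apply, smul_eq_mul]
  simp only [twirl, Matrix.of_apply]
  rw [← integral_const_mul]
  refine integral_congr_ae (Filter.Eventually.of_forall fun U => ?_)
  exact congrArg (fun w : TensorSpace k k => w x) (hU U π hπ)

/-- The block of a matrix on `(ℂ^k)^{⊗k} ⊗ (ℂ^d ⊗ ℂ^d)` at a pair of basis vectors of the second
factor. -/
def blockAt (τ : Matrix ((Fin k → Fin k) × (Fin d × Fin d)) ((Fin k → Fin k) × (Fin d × Fin d)) ℂ)
    (a b : Fin d × Fin d) : TensorSpace k k →ₗ[ℂ] TensorSpace k k :=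
  Matrix.toEuclideanLin (Matrix.of fun x y => τ (x, a) (y, b))

theorem blockAt_apply
    (τ : Matrix ((Fin k → Fin k) × (Fin d × Fin d)) ((Fin k → Fin k) × (Fin d × Fin d)) ℂ)
    (a b : Fin d × Fin d) (v : TensorSpace k k) (x : Fin k → Fin k) :
    blockAt τ a b v x = ∑ y, τ (x, a) (y, b) * v y := rfl

theorem blockAt_twirl_unitaryAct (a c : Fin d × Fin d) (U : UG k) (v : TensorSpace k k) :
    blockAt (twirl σ) a c (unitaryAct k U v) = unitaryAct k U (blockAt (twirl σ) a c v) := by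
  have hentry : ∀ x y, ∑ z, twirl σ (x, a) (z, c) * tensorPow k (U : Matrix _ _ ℂ) z y =
      ∑ z, tensorPow k (U : Matrix _ _ ℂ) x z * twirl σ (z, a) (y, c) := by
    intro x y
    have h := congrFun (congrFun (auxUnitary_mul_twirl (σ := σ) U) (x, a)) (y, c)
    rw [Matrix.mul_apply, Matrix.mul_apply, Fintype.sum_prod_type, Fintype.sum_prod_type] at h
    simpa [auxUnitary, Matrix.kroneckerMap_apply, Matrix.one_apply] using h.symm
  ext x
  simp only [blockAt_apply, unitaryAct_apply, Finset.mul_sum, ← mul_assoc]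
  rw [Finset.sum_comm]
  refine Eq.trans (Finset.sum_congr rfl fun y _ => ?_) Finset.sum_comm
  rw [← Finset.sum_mul, ← Finset.sum_mul, hentry]

theorem blockAt_mem_altSpace {b : Fin k}
    {τ : Matrix ((Fin k → Fin k) × (Fin d × Fin d)) ((Fin k → Fin k) × (Fin d × Fin d)) ℂ}
    (hτ : ∀ a q, (WithLp.toLp 2 fun x => τ (x, a) q : TensorSpace k k) ∈ altSpace b)
    (a c : Fin d × Fin d) (v : TensorSpace k k) : blockAt τ a c v ∈ altSpace b := by
  have : blockAt τ a c v = ∑ y, v y • (WithLp.toLp 2 fun x => τ (x, a) (y, c) :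
      TensorSpace k k) := by
    ext x
    simp only [blockAt_apply, WithLp.ofLp_sum, Finset.sum_apply, PiLp.smul_apply, smul_eq_mul]
    exact Finset.sum_congr rfl fun r _ => mul_comm _ _
  rw [this]
  exact Submodule.sum_mem _ fun r _ => Submodule.smul_mem _ _ (hτ a _)

theorem inner_blockAt
    {τ : Matrix ((Fin k → Fin k) × (Fin d × Fin d)) ((Fin k → Fin k) × (Fin d × Fin d)) ℂ}
    (hτ : τ.IsHermitian) (a c : Fin d × Fin d) (u v : TensorSpace k k) :
    inner ℂ (blockAt τ c a u) v = inner ℂ u (blockAt τ a c v) := by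
  simp only [PiLp.inner_apply, RCLike.inner_apply, blockAt_apply, map_sum, Finset.mul_sum,
    Finset.sum_mul]
  rw [Finset.sum_comm]
  refine Finset.sum_congr rfl fun x _ => Finset.sum_congr rfl fun y _ => ?_
  have h : (starRingEnd ℂ) (τ (y, c) (x, a)) = τ (x, a) (y, c) := hτ.apply (x, a) (y, c)
  rw [map_mul, h]
  ring

/-- The adjoint of the block at `(a, c)` is the block at `(c, a)`, which also has range in `altSpace
b`; so the kernel contains the orthogonal complement of that space. -/
theorem blockAt_eq_zero {b : Fin k}
    {τ : Matrix ((Fin k → Fin k) × (Fin d × Fin d)) ((Fin k → Fin k) × (Fin d × Fin d)) ℂ}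
    (hherm : τ.IsHermitian)
    (hτ : ∀ a q, (WithLp.toLp 2 fun x => τ (x, a) q : TensorSpace k k) ∈ altSpace b)
    (a c : Fin d × Fin d) {v : TensorSpace k k} (hv : ∀ u ∈ altSpace b, inner ℂ u v = 0) :
    blockAt τ a c v = 0 := by
  rw [← inner_self_eq_zero (𝕜 := ℂ), ← inner_blockAt hherm]
  exact hv _ (blockAt_mem_altSpace hτ c a _)

/-- The twirl of a state alternating in all slots but one is a combination of two projectors with
coefficients in the second factor. -/
theorem exists_twirl_eq (hk : 2 ≤ k) (b : Fin k) (hσ : σ.PosSemidef)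
    (hcol : ∀ a q, (WithLp.toLp 2 fun x => σ (x, a) q : TensorSpace k k) ∈ altSpace b) :
    ∃ α β : Matrix (Fin d × Fin d) (Fin d × Fin d) ℂ,
      twirl σ = projMatrix (Submodule.span ℂ {detVector k}) ⊗ₖ α +
        projMatrix (tracelessSpace b) ⊗ₖ β := by
  have hcol' := fun a q => twirl_column_mem_altSpace hcol a q
  have h := fun a c => exists_eq_smul_starProjection hk (N := blockAt (twirl σ) a c) (b := b)
    (fun U v => blockAt_twirl_unitaryAct a c U v) (fun v => blockAt_mem_altSpace hcol' a c v)
    (fun v hv => blockAt_eq_zero (posSemidef_twirl hσ).1 hcol' a c hv)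
  choose α β hαβ using h
  refine ⟨Matrix.of α, Matrix.of β, ?_⟩
  ext ⟨x, a⟩ ⟨y, c⟩
  have h1 := congrArg (fun w : TensorSpace k k => w x)
    (hαβ a c (EuclideanSpace.single y (1 : ℂ)))
  simp only [blockAt_apply, PiLp.add_apply, PiLp.smul_apply, smul_eq_mul] at h1
  simp only [Matrix.add_apply, Matrix.kroneckerMap_apply, projMatrix, Matrix.of_apply]
  rw [mul_comm _ (α a c), mul_comm _ (β a c), ← h1]
  simp

/-- The compression of a positive semidefinite matrix by a vector of the first factor. -/
theorem posSemidef_compression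
    {τ : Matrix ((Fin k → Fin k) × (Fin d × Fin d)) ((Fin k → Fin k) × (Fin d × Fin d)) ℂ}
    (hτ : τ.PosSemidef) (e : TensorSpace k k) :
    (Matrix.of fun a c => inner ℂ e (blockAt τ a c e)).PosSemidef := by
  let E : Matrix ((Fin k → Fin k) × (Fin d × Fin d)) (Fin d × Fin d) ℂ :=
    Matrix.of fun p a => if p.2 = a then e p.1 else 0
  convert hτ.conjTranspose_mul_mul_same E using 1
  ext a c
  rw [Matrix.of_apply, Matrix.mul_assoc, Matrix.mul_apply, Fintype.sum_prod_type, PiLp.inner_apply]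
  refine Finset.sum_congr rfl fun x _ => ?_
  rw [Finset.sum_eq_single a, Matrix.mul_apply, Fintype.sum_prod_type, RCLike.inner_apply,
    blockAt_apply, mul_comm]
  · congr 1
    · simp [E]
    · refine Finset.sum_congr rfl fun y _ => ?_
      simp [E]
  · intro a' _ ha
    simp [E, ha]
  · simp

theorem inner_blockAt_kronecker (W W' : Submodule ℂ (TensorSpace k k))
    (α β : Matrix (Fin d × Fin d) (Fin d × Fin d) ℂ) (a c : Fin d × Fin d) (e : TensorSpace k k) :
    inner ℂ e (blockAt (projMatrix W ⊗ₖ α + projMatrix W' ⊗ₖ β) a c e) =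
      α a c * inner ℂ e (W.starProjection e) + β a c * inner ℂ e (W'.starProjection e) := by
  have : blockAt (projMatrix W ⊗ₖ α + projMatrix W' ⊗ₖ β) a c e =
      α a c • W.starProjection e + β a c • W'.starProjection e := by
    ext x
    rw [blockAt_apply, PiLp.add_apply, PiLp.smul_apply, PiLp.smul_apply, starProjection_eq_sum,
      starProjection_eq_sum, smul_eq_mul, smul_eq_mul, Finset.mul_sum, Finset.mul_sum,
      ← Finset.sum_add_distrib]
    refine Finset.sum_congr rfl fun y _ => ?_
    simp only [Matrix.add_apply, Matrix.kroneckerMap_apply]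
    ring
  rw [this, inner_add_right, inner_smul_right, inner_smul_right]

/-- Compression by a nonzero `e ∈ W` removes the second term and turns the first into `‖e‖²` times
`α`. -/
theorem posSemidef_of_kronecker_add {W W' : Submodule ℂ (TensorSpace k k)} (hW : W ⟂ W')
    (hne : W ≠ ⊥) {α β : Matrix (Fin d × Fin d) (Fin d × Fin d) ℂ}
    (hpos : (projMatrix W ⊗ₖ α + projMatrix W' ⊗ₖ β).PosSemidef) : α.PosSemidef := by
  obtain ⟨e, he, he0⟩ := W.ne_bot_iff.mp hne
  have hc := posSemidef_compression hpos e
  have h1 : W.starProjection e = e := Submodule.starProjection_eq_self_iff.mpr he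
  have h2 : W'.starProjection e = 0 :=
    (Submodule.starProjection_apply_eq_zero_iff W').mpr (hW he)
  have hne' : (inner ℂ e e : ℂ) ≠ 0 := inner_self_ne_zero.mpr he0
  have hα : α = (inner ℂ e e : ℂ)⁻¹ • Matrix.of fun a c =>
      inner ℂ e (blockAt (projMatrix W ⊗ₖ α + projMatrix W' ⊗ₖ β) a c e) := by
    ext a c
    rw [Matrix.smul_apply, Matrix.of_apply, inner_blockAt_kronecker, h1, h2, inner_zero_right,
      mul_zero, add_zero, smul_eq_mul, mul_comm (α a c), inv_mul_cancel_left₀ hne']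
  rw [hα]
  refine hc.smul ?_
  rw [inv_nonneg]
  exact Complex.nonneg_iff.mpr ⟨inner_self_nonneg (𝕜 := ℂ), (inner_self_im (𝕜 := ℂ) e).symm⟩

/-- A positive semidefinite matrix is a nonnegative multiple of a density matrix. -/
theorem exists_density {ι : Type*} [Fintype ι] [Nonempty ι] {α : Matrix ι ι ℂ}
    (hα : α.PosSemidef) : ∃ (w : ℝ) (τ : Matrix ι ι ℂ), 0 ≤ w ∧ τ.PosSemidef ∧ τ.trace = 1 ∧
      α = (w : ℂ) • τ ∧ α.trace = w := by
  classical
  obtain ⟨hre, him⟩ := Complex.nonneg_iff.mp hα.trace_nonneg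
  have htr : α.trace = (α.trace.re : ℂ) := Complex.ext rfl him.symm
  by_cases h0 : α.trace = 0
  · obtain ⟨i⟩ := ‹Nonempty ι›
    -- With zero trace the matrix is zero and any state will do; the maximally mixed one is taken.
    refine ⟨0, (Fintype.card ι : ℂ)⁻¹ • 1, le_rfl, Matrix.PosSemidef.one.smul ?_, ?_, ?_, ?_⟩
    · rw [inv_nonneg]
      exact_mod_cast Nat.zero_le _
    · rw [Matrix.trace_smul, Matrix.trace_one, smul_eq_mul, inv_mul_cancel₀]
      exact_mod_cast (Fintype.card_pos_iff.mpr ⟨i⟩).ne'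
    · rw [hα.trace_eq_zero_iff.mp h0, Complex.ofReal_zero, zero_smul]
    · rw [h0, Complex.ofReal_zero]
  · refine ⟨α.trace.re, α.trace⁻¹ • α, hre, hα.smul ?_, ?_, ?_, htr⟩
    · rw [inv_nonneg]
      exact hα.trace_nonneg
    · rw [Matrix.trace_smul, smul_eq_mul, inv_mul_cancel₀ h0]
    · rw [← htr, smul_smul, mul_inv_cancel₀ h0, one_smul]

end Blocks

/-! ### Assembly of the decomposition -/

theorem exists_twirl_dualize {d : ℕ} (hk : 2 ≤ k)
    {ρ : Matrix ((Fin k × Fin k) × (Fin d × Fin d)) ((Fin k × Fin k) × (Fin d × Fin d)) ℂ}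
    (hρ : ρ.PosSemidef) (htr : ρ.trace = 1) :
    ∃ (w₁ w₂ : ℝ) (ρ₁ ρ₂ : Matrix (Fin d × Fin d) (Fin d × Fin d) ℂ),
      0 ≤ w₁ ∧ 0 ≤ w₂ ∧ w₁ + w₂ = 1 ∧
      ρ₁.PosSemidef ∧ ρ₁.trace = 1 ∧ ρ₂.PosSemidef ∧ ρ₂.trace = 1 ∧
      twirl (dualize hk ρ) =
        (w₁ : ℂ) • (projMatrix (Submodule.span ℂ {detVector k}) ⊗ₖ ρ₁) +
        ((w₂ : ℂ) / ((k : ℂ) ^ 2 - 1)) • (projMatrix (tracelessSpace (bob hk)) ⊗ₖ ρ₂) := by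
  -- The case `d = 0` is excluded by the trace: a matrix on the empty index set cannot have trace
  -- one.
  have hd : Nonempty (Fin d × Fin d) := by
    by_contra hempty
    rw [not_nonempty_iff] at hempty
    rw [Matrix.trace, Finset.univ_eq_empty, Finset.sum_empty] at htr
    exact zero_ne_one htr
  have hpos := posSemidef_dualize hk hρ
  obtain ⟨α, β, h⟩ := exists_twirl_eq hk (bob hk) hpos (dualize_column_mem_altSpace hk ρ)
  have hort := isOrtho_span_detVector_tracelessSpace (bob hk)
  have htpos := posSemidef_twirl hpos
  rw [h] at htpos
  have hα : α.PosSemidef := posSemidef_of_kronecker_add hort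
    isIrreducible_span_detVector.2.1 htpos
  rw [add_comm] at htpos
  have hβ : β.PosSemidef := posSemidef_of_kronecker_add hort.symm
    (isIrreducible_tracelessSpace hk (bob hk)).2.1 htpos
  obtain ⟨w₁, ρ₁, hw₁, hρ₁, hρ₁t, hα', hαt⟩ := exists_density hα
  obtain ⟨u, ρ₂, hu, hρ₂, hρ₂t, hβ', hβt⟩ := exists_density hβ
  have hk1 : (0 : ℝ) < (k : ℝ) ^ 2 - 1 := by
    have : (2 : ℝ) ≤ k := by exact_mod_cast hk
    nlinarith
  have hk1' : ((k : ℂ) ^ 2 - 1) ≠ 0 := by exact_mod_cast hk1.ne'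
  -- The projector onto the traceless part has trace `k² - 1`; this factor goes into the weight and
  -- is divided out in the formula.
  refine ⟨w₁, ((k : ℝ) ^ 2 - 1) * u, ρ₁, ρ₂, hw₁, mul_nonneg hk1.le hu, ?_, hρ₁, hρ₁t, hρ₂, hρ₂t,
    ?_⟩
  · have h1 := congrArg Matrix.trace h
    rw [trace_twirl, trace_dualize, htr, Matrix.trace_add, Matrix.trace_kronecker,
      Matrix.trace_kronecker, trace_projMatrix, trace_projMatrix, finrank_span_detVector,
      finrank_tracelessSpace, hαt, hβt, Nat.cast_sub (Nat.one_le_pow _ _ (by omega))] at h1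
    push_cast at h1
    rw [one_mul] at h1
    exact_mod_cast h1.symm
  · rw [h, hα', hβ', Matrix.kronecker_smul, Matrix.kronecker_smul]
    congr 2
    push_cast
    rw [mul_div_cancel_left₀ _ hk1']

theorem isOrtho_diagramBlock (hk : 2 ≤ k) {μ : YoungDiagram} (t : StdTableau k μ)
    (hcol : μ ≠ colShape k) (hhook : μ ≠ hookShape k) (b : Fin k) :
    diagramBlock k t ⟂ altSpace b := by
  rw [Submodule.isOrtho_comm, Submodule.isOrtho_iff_inner_eq]
  intro u hu v hv
  exact inner_eq_zero_of_slotAlt_eq_zero hu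
    (slotAlt_eq_zero_of_mem_diagramBlock hk t hcol hhook b hv)

theorem span_detVector_le_altSpace (b : Fin k) :
    Submodule.span ℂ {detVector k} ≤ altSpace b := by
  rw [Submodule.span_singleton_le_iff_mem]
  exact fun π _ => permRep_detVector π

end Twirl

end

theorem mainTheorem5 (k d : ℕ) (hk : 2 ≤ k) :
    -- the two blocks `|a⟩ ⊗ 𝕌_{k,(1^k)}` and `|s⟩ ⊗ 𝕌_{k,(2,1^{k-2})}`
    (Twirl.IsIrreducible (Twirl.tableauSpace k (Twirl.colTableau k)) ∧
      Twirl.AreEquivalent (Twirl.weylModule k (Twirl.colTableau k))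
        (Twirl.tableauSpace k (Twirl.colTableau k)) ∧
      Module.finrank ℂ (Twirl.tableauSpace k (Twirl.colTableau k)) = 1) ∧
    (Twirl.IsIrreducible (Twirl.tableauSpace k (Twirl.hookTableau hk)) ∧
      Twirl.AreEquivalent (Twirl.weylModule k (Twirl.hookTableau hk))
        (Twirl.tableauSpace k (Twirl.hookTableau hk)) ∧
      Module.finrank ℂ (Twirl.tableauSpace k (Twirl.hookTableau hk)) = k ^ 2 - 1) ∧
    Twirl.tableauSpace k (Twirl.colTableau k) ⟂ Twirl.tableauSpace k (Twirl.hookTableau hk) ∧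
    -- the decomposition of the twirled state
    ∀ ρ : Matrix ((Fin k × Fin k) × (Fin d × Fin d)) ((Fin k × Fin k) × (Fin d × Fin d)) ℂ,
      ρ.PosSemidef → ρ.trace = 1 →
      (∃ (w₁ w₂ : ℝ) (ρ₁ ρ₂ : Matrix (Fin d × Fin d) (Fin d × Fin d) ℂ),
        0 ≤ w₁ ∧ 0 ≤ w₂ ∧ w₁ + w₂ = 1 ∧
        ρ₁.PosSemidef ∧ ρ₁.trace = 1 ∧ ρ₂.PosSemidef ∧ ρ₂.trace = 1 ∧
        Twirl.twirl (Twirl.dualize hk ρ) =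
          (w₁ : ℂ) • (Twirl.projMatrix (Twirl.tableauSpace k (Twirl.colTableau k)) ⊗ₖ ρ₁) +
          ((w₂ : ℂ) / ((k : ℂ) ^ 2 - 1)) •
            (Twirl.projMatrix (Twirl.tableauSpace k (Twirl.hookTableau hk)) ⊗ₖ ρ₂)) ∧
      -- the block of every other Young diagram with `k` boxes vanishes
      ∀ (μ : YoungDiagram) (t : Twirl.StdTableau k μ),
        μ ≠ Twirl.colShape k → μ ≠ Twirl.hookShape k →
        (Twirl.projMatrix (Twirl.diagramBlock k t) ⊗ₖ
          (1 : Matrix (Fin d × Fin d) (Fin d × Fin d) ℂ)) *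
            Twirl.twirl (Twirl.dualize hk ρ) = 0 := by
  refine ⟨⟨?_, Twirl.areEquivalent_colTableau, ?_⟩,
    ⟨?_, Twirl.areEquivalent_hookTableau hk, ?_⟩, ?_, ?_⟩
  · rw [Twirl.tableauSpace_colTableau]
    exact Twirl.isIrreducible_span_detVector
  · rw [Twirl.tableauSpace_colTableau]
    exact Twirl.finrank_span_detVector
  · rw [Twirl.tableauSpace_hookTableau]
    exact Twirl.isIrreducible_tracelessSpace hk _
  · rw [Twirl.tableauSpace_hookTableau]
    exact Twirl.finrank_tracelessSpace _
  · rw [Twirl.tableauSpace_colTableau, Twirl.tableauSpace_hookTableau]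
    exact Twirl.isOrtho_span_detVector_tracelessSpace _
  · intro ρ hρ htr
    rw [Twirl.tableauSpace_colTableau, Twirl.tableauSpace_hookTableau]
    have h := Twirl.exists_twirl_dualize hk hρ htr
    refine ⟨h, fun μ t hcol hhook => ?_⟩
    obtain ⟨w₁, w₂, ρ₁, ρ₂, -, -, -, -, -, -, -, h⟩ := h
    have hort := Twirl.isOrtho_diagramBlock hk t hcol hhook (Twirl.bob hk)
    -- The block is orthogonal to `altSpace`, which contains the ranges of both projectors in the
    -- decomposition.
    rw [h, mul_add, mul_smul_comm, mul_smul_comm, ← Matrix.mul_kronecker_mul,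
      ← Matrix.mul_kronecker_mul,
      Twirl.projMatrix_mul_eq_zero (hort.mono_right (Twirl.span_detVector_le_altSpace _)),
      Twirl.projMatrix_mul_eq_zero (hort.mono_right (Twirl.tracelessSpace_le_altSpace _)),
      Matrix.zero_kronecker, Matrix.zero_kronecker, smul_zero, smul_zero, add_zero]
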